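/- Let $G$ be a group and $N$ a normal subgroup of $G$. Let $\mathrm{Q}(N)^G$ be the real vector space of $G$-conjugation-invariant homogeneous quasimorphisms $N\to\mathbb{R}$, and $\mathrm{H}^1(N)^G\subseteq \mathrm{Q}(N)^G$ the subspace of $G$-invariant homomorphisms. Let $[G,N]$ be the subgroup generated by the simple commutators $gxg^{-1}x^{-1}$ ($g\in G$, $x\in N$), let $\mathrm{cl}_{G,N}$ be the word length on $[G,N]$ with respect to them, and $\mathrm{scl}_{G,N}(y)=\lim_{n\to\infty}\mathrm{cl}_{G,N}(y^n)/n$. Put $d_{\mathrm{cl}}(y,y')=\mathrm{cl}_{G,N}(y^{-1}y')$ and $d_{\mathrm{scl}}(y,y')=\mathrm{scl}_{G,N}(y^{-1}y')$ on $[G,N]$. An almost metric is a symmetric function $d\ge 0$ with $d(x,x)=0$ that satisfies the triangle inequality up to a uniform additive constant. For groups $X,Y$ with bi-invariant almost metrics $d_X,d_Y$: a map $\alpha\colon X\to Y$ is a pre-coarse homomorphism if $\sup_{x,x'}d_Y(\alpha(xx'),\alpha(x)\alpha(x'))<\infty$ (a condition that involves only $d_Y$); it is controlled if for every $S$ there is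 $T$ such that $d_X(x,x')\le S$ implies $d_Y(\alpha(x),\alpha(x'))\le T$; it is a quasi-isometric embedding if $C_1d_X(x,x')-D_1\le d_Y(\alpha(x),\alpha(x'))\le C_2d_X(x,x')+D_2$ for some constants $C_1,C_2>0$, $D_1,D_2\ge0$. Controlled maps $\alpha\colon X\to Y$, $\beta\colon Y\to X$ are coarse inverse to each other if $\sup_x d_X(\beta\alpha(x),x)<\infty$ and $\sup_y d_Y(\alpha\beta(y),y)<\infty$. A quasi-isometry is a quasi-isometric embedding with a coarse inverse that is also a quasi-isometric embedding. $X$ and $Y$ are isomorphic as coarse groups if there are controlled pre-coarse homomorphisms $\alpha\colon X\to Y$ and $\beta\colon Y\to X$ that are coarse inverse to each other. Assume that $\mathrm{Q}(N)^G/\mathrm{H}^1(N)^G$ is finite dimensional, of dimension $\ell$. Then $d_{\mathrm{scl}}$ is a bi-invariant almost metric on $[G,N]$, and $([G,N],d_{\mathrm{scl}})$ is isomorphic as a coarse group to $(\mathbb{Z}^\ell,\|\cdot\|_1)$ (with $\mathbb{Z}^0=0$), by maps in both directions that are quasi-isometries. More precisely: There exist $\nu_1,\dots,\nu_\ell\in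 \mathrm{Q}(N)^G$ and $y_1,\dots,y_\ell\in[G,N]$ with $\nu_j(y_i)=\delta_{i,j}$ for all $i,j$. For any such families, the classes $[\nu_1],\dots,[\nu_\ell]$ form a basis of $\mathrm{Q}(N)^G/\mathrm{H}^1(N)^G$, and for every map $\rho\colon\mathbb{R}^\ell\to\mathbb{Z}^\ell$ with $\sup_u\|u-\rho(u)\|_1<\infty$ (for example, the coordinatewise floor), the maps $$\sigma\colon[G,N]\to\mathbb{Z}^\ell,\ \ \sigma(y)=\rho(\nu_1(y),\dots,\nu_\ell(y)),\qquad \tau\colon\mathbb{Z}^\ell\to[G,N],\ \ \tau(m_1,\dots,m_\ell)=y_1^{m_1}\cdots y_\ell^{m_\ell}$$ satisfy the following. (1) $\sigma\colon[G,N]\to(\mathbb{Z}^\ell,\|\cdot\|_1)$ and $\tau\colon\mathbb{Z}^\ell\to([G,N],d_{\mathrm{cl}})$ are pre-coarse homomorphisms. (2) $\sigma\colon([G,N],d_{\mathrm{scl}})\to(\mathbb{Z}^\ell,\|\cdot\|_1)$ is a quasi-isometric embedding. (3) There are $C,C'>0$ and $D,D'\ge0$ such that for all $m,n\in\mathbb{Z}^\ell$,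 $$C\|m-n\|_1-D\le d_{\mathrm{scl}}(\tau(m),\tau(n))\le d_{\mathrm{cl}}(\tau(m),\tau(n))\le C'\|m-n\|_1+D'.$$ (4) $\sigma\colon([G,N],d_{\mathrm{scl}})\to(\mathbb{Z}^\ell,\|\cdot\|_1)$ and $\tau\colon(\mathbb{Z}^\ell,\|\cdot\|_1)\to([G,N],d_{\mathrm{scl}})$ are controlled and coarse inverse to each other. In particular, $\sigma$ and $\tau$ are quasi-isometries and mutually inverse isomorphisms of coarse groups between $([G,N],d_{\mathrm{scl}})$ and $(\mathbb{Z}^\ell,\|\cdot\|_1)$. -/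

import Mathlib

noncomputable section

/-! ### Quasimorphisms -/

/-- `ψ : H → ℝ` is a quasimorphism: its defect `sup |ψ(ab) - ψ(a) - ψ(b)|` is finite. -/
def IsQuasimorphism {H : Type*} [Group H] (ψ : H → ℝ) : Prop :=
  ∃ D : ℝ, ∀ a b : H, |ψ (a * b) - ψ a - ψ b| ≤ D

/-- `ψ(gⁿ) = n ψ(g)` for all `g` and all integers `n`. -/
def IsHomogeneous {H : Type*} [Group H] (ψ : H → ℝ) : Prop :=
  ∀ (g : H) (n : ℤ), ψ (g ^ n) = (n : ℝ) * ψ g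

/-- `ν : N → ℝ` is invariant under conjugation by elements of the ambient group
(`MulAut.conjNormal g x` is `g x g⁻¹` as an element of `N`). -/
def IsConjInvariant {G : Type*} [Group G] (N : Subgroup G) [N.Normal] (ν : N → ℝ) : Prop :=
  ∀ (g : G) (x : N), ν (MulAut.conjNormal g x) = ν x

/-- `Q(N)^G`: the space of `G`-invariant homogeneous quasimorphisms on `N`. -/
def invQuasimorphisms {G : Type*} [Group G] (N : Subgroup G) [N.Normal] :
    Submodule ℝ (N → ℝ) where
  carrier := {ν | IsQuasimorphism ν ∧ IsHomogeneous ν ∧ IsConjInvariant N ν}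
  add_mem' := by
    rintro a b ⟨⟨D, hD⟩, ha, ha'⟩ ⟨⟨E, hE⟩, hb, hb'⟩
    refine ⟨⟨D + E, fun x y => ?_⟩, fun g n => ?_, fun g x => ?_⟩
    · have h : (a + b) (x * y) - (a + b) x - (a + b) y
          = (a (x * y) - a x - a y) + (b (x * y) - b x - b y) := by
        simp only [Pi.add_apply]; ring
      rw [h]
      exact (abs_add_le _ _).trans (add_le_add (hD x y) (hE x y))
    · simp only [Pi.add_apply, ha g n, hb g n]; ring
    · simp only [Pi.add_apply, ha' g x, hb' g x]
  zero_mem' := ⟨⟨0, by simp⟩, fun g n => by simp, fun g x => rfl⟩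
  smul_mem' := by
    rintro c a ⟨⟨D, hD⟩, ha, ha'⟩
    refine ⟨⟨|c| * D, fun x y => ?_⟩, fun g n => ?_, fun g x => ?_⟩
    · have h : (c • a) (x * y) - (c • a) x - (c • a) y
          = c * (a (x * y) - a x - a y) := by
        simp only [Pi.smul_apply, smul_eq_mul]; ring
      rw [h, abs_mul]
      exact mul_le_mul_of_nonneg_left (hD x y) (abs_nonneg c)
    · simp only [Pi.smul_apply, smul_eq_mul, ha g n]; ring
    · simp only [Pi.smul_apply, ha' g x]

/-- `H¹(N)^G`: the space of `G`-invariant homomorphisms `N → ℝ`. -/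
def invHomomorphisms {G : Type*} [Group G] (N : Subgroup G) [N.Normal] :
    Submodule ℝ (N → ℝ) where
  carrier := {k | (∀ x y : N, k (x * y) = k x + k y) ∧ IsConjInvariant N k}
  add_mem' := by
    rintro a b ⟨ha, ha'⟩ ⟨hb, hb'⟩
    refine ⟨fun x y => ?_, fun g x => ?_⟩
    · simp only [Pi.add_apply, ha x y, hb x y]; ring
    · simp only [Pi.add_apply, ha' g x, hb' g x]
  zero_mem' := ⟨by simp, fun g x => rfl⟩
  smul_mem' := by
    rintro c a ⟨ha, ha'⟩
    refine ⟨fun x y => ?_, fun g x => ?_⟩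
    · simp only [Pi.smul_apply, smul_eq_mul, ha x y]; ring
    · simp only [Pi.smul_apply, ha' g x]

theorem invHomomorphisms_le {G : Type*} [Group G] (N : Subgroup G) [N.Normal] :
    invHomomorphisms N ≤ invQuasimorphisms N := by
  rintro k ⟨hk, hk'⟩
  refine ⟨⟨0, fun a b => by simp [hk a b]⟩, fun g n => ?_, hk'⟩
  let f : N →* Multiplicative ℝ := MonoidHom.mk' (fun x => Multiplicative.ofAdd (k x))
    (fun x y => by rw [hk x y, ofAdd_add])
  have h := congrArg Multiplicative.toAdd (map_zpow f g n)
  simpa [f, zsmul_eq_mul] using h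

/-- The real vector space `Q(N)^G / H¹(N)^G`. -/
abbrev InvQuotient {G : Type*} [Group G] (N : Subgroup G) [N.Normal] : Type _ :=
  invQuasimorphisms N ⧸ (invHomomorphisms N).submoduleOf (invQuasimorphisms N)

/-- The class `[ν]` of `ν` in `Q(N)^G / H¹(N)^G`. -/
def invClass {G : Type*} [Group G] {N : Subgroup G} [N.Normal]
    (ν : invQuasimorphisms N) : InvQuotient N :=
  Submodule.Quotient.mk ν

/-! ### Mixed commutator lengths -/

/-- The mixed commutator subgroup `[G,N]`. -/
abbrev mixedCommutator {G : Type*} [Group G] (N : Subgroup G) : Subgroup G :=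
  ⁅(⊤ : Subgroup G), N⁆

/-- A simple `(G,N)`-commutator: an element `[g,x] = g x g⁻¹ x⁻¹` with `g ∈ G`, `x ∈ N`. -/
def IsSimpleCommutator {G : Type*} [Group G] (N : Subgroup G) (c : G) : Prop :=
  ∃ g : G, ∃ x ∈ N, g * x * g⁻¹ * x⁻¹ = c

/-- The lengths of the expressions of `y` as a product of simple `(G,N)`-commutators. -/
def commutatorLengths {G : Type*} [Group G] (N : Subgroup G) (y : G) : Set ℕ :=
  {n | ∃ l : List G, l.length = n ∧ (∀ c ∈ l, IsSimpleCommutator N c) ∧ l.prod = y}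

/-- The mixed commutator length `cl_{G,N}` on `[G,N]`. -/
def mixedCl {G : Type*} [Group G] (N : Subgroup G) (y : mixedCommutator N) : ℕ :=
  sInf (commutatorLengths N (y : G))

/-- The stable mixed commutator length `scl_{G,N}(y) = lim cl_{G,N}(yⁿ) / n`; the limit exists
by `tendsto_mixedScl`. -/
def mixedScl {G : Type*} [Group G] (N : Subgroup G) (y : mixedCommutator N) : ℝ :=
  Filter.limUnder Filter.atTop (fun n : ℕ => (mixedCl N (y ^ n) : ℝ) / n)

theorem IsSimpleCommutator.inv {G : Type*} [Group G] {N : Subgroup G} [hN : N.Normal] {c : G}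
    (h : IsSimpleCommutator N c) : IsSimpleCommutator N c⁻¹ := by
  obtain ⟨g, x, hx, rfl⟩ := h
  refine ⟨g⁻¹, g * x * g⁻¹, hN.conj_mem x hx g, ?_⟩
  group

/-- Every element of `[G,N]` is a product of simple `(G,N)`-commutators. -/
theorem commutatorLengths_nonempty {G : Type*} [Group G] (N : Subgroup G) [N.Normal]
    (y : mixedCommutator N) : (commutatorLengths N (y : G)).Nonempty := by
  obtain ⟨y, hy⟩ := y
  change (commutatorLengths N y).Nonempty
  rw [mixedCommutator, Subgroup.commutator_def] at hy
  induction hy using Subgroup.closure_induction with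
  | mem c hc =>
    obtain ⟨g, -, x, hx, rfl⟩ := hc
    exact ⟨1, [g * x * g⁻¹ * x⁻¹], rfl, by simpa using ⟨g, x, hx, rfl⟩,
      by simp [commutatorElement_def]⟩
  | one => exact ⟨0, [], rfl, by simp, rfl⟩
  | mul a b _ _ ha hb =>
    obtain ⟨n, l, hl, hc, rfl⟩ := ha
    obtain ⟨m, l', hl', hc', rfl⟩ := hb
    refine ⟨n + m, l ++ l', by simp [hl, hl'], fun c h => ?_, by simp⟩
    exact (List.mem_append.1 h).elim (hc c) (hc' c)
  | inv a _ ha =>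
    obtain ⟨n, l, hl, hc, rfl⟩ := ha
    refine ⟨n, (l.map fun c => c⁻¹).reverse, by simp [hl], fun c h => ?_, ?_⟩
    · obtain ⟨d, hd, rfl⟩ := List.mem_map.1 (List.mem_reverse.1 h)
      exact (hc d hd).inv
    · rw [List.prod_inv_reverse]

theorem mixedCl_mul_le {G : Type*} [Group G] (N : Subgroup G) [N.Normal]
    (y z : mixedCommutator N) : mixedCl N (y * z) ≤ mixedCl N y + mixedCl N z := by
  obtain ⟨l, hl, hc, hp⟩ := Nat.sInf_mem (commutatorLengths_nonempty N y)
  obtain ⟨l', hl', hc', hp'⟩ := Nat.sInf_mem (commutatorLengths_nonempty N z)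
  refine Nat.sInf_le ⟨l ++ l', ?_, fun c h => ?_, ?_⟩
  · rw [List.length_append, hl, hl', mixedCl, mixedCl]
  · exact (List.mem_append.1 h).elim (hc c) (hc' c)
  · rw [List.prod_append, hp, hp', Subgroup.coe_mul]

/-- The limit defining `scl_{G,N}` exists. -/
theorem tendsto_mixedScl {G : Type*} [Group G] (N : Subgroup G) [N.Normal]
    (y : mixedCommutator N) :
    Filter.Tendsto (fun n : ℕ => (mixedCl N (y ^ n) : ℝ) / n) Filter.atTop
      (nhds (mixedScl N y)) := by
  have hs : Subadditive fun n : ℕ => (mixedCl N (y ^ n) : ℝ) := fun m n => by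
    simp only [pow_add]
    exact_mod_cast mixedCl_mul_le N (y ^ m) (y ^ n)
  have hb : BddBelow (Set.range fun n : ℕ => (mixedCl N (y ^ n) : ℝ) / n) :=
    ⟨0, by rintro _ ⟨n, rfl⟩; positivity⟩
  rw [mixedScl]
  exact tendsto_nhds_limUnder ⟨_, hs.tendsto_lim hb⟩

/-- The metric `d_cl(y₁, y₂) = cl_{G,N}(y₁⁻¹ y₂)` on `[G,N]`. -/
def clDist {G : Type*} [Group G] (N : Subgroup G) (y₁ y₂ : mixedCommutator N) : ℝ :=
  (mixedCl N (y₁⁻¹ * y₂) : ℝ)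

/-- The almost metric `d_scl(y₁, y₂) = scl_{G,N}(y₁⁻¹ y₂)` on `[G,N]`. -/
def sclDist {G : Type*} [Group G] (N : Subgroup G) (y₁ y₂ : mixedCommutator N) : ℝ :=
  mixedScl N (y₁⁻¹ * y₂)

/-! ### Coarse geometry of groups with bi-invariant almost metrics -/

/-- `d` is a bi-invariant almost metric on the group `X`: the triangle inequality holds up to
a uniform additive error, and points at distance zero need not coincide. -/
structure IsBiinvariantAlmostMetric {X : Type*} [Group X] (d : X → X → ℝ) : Prop where
  nonneg : ∀ x y, 0 ≤ d x y
  self : ∀ x, d x x = 0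
  symm : ∀ x y, d x y = d y x
  triangle : ∃ C : ℝ, ∀ x y z, d x z ≤ d x y + d y z + C
  biinvariant : ∀ a b x y, d (a * x * b) (a * y * b) = d x y

def IsControlled {X Y : Type*} (dX : X → X → ℝ) (dY : Y → Y → ℝ) (α : X → Y) : Prop :=
  ∀ S : ℝ, ∃ T : ℝ, ∀ x x', dX x x' ≤ S → dY (α x) (α x') ≤ T

/-- `α ≈ β`: the maps are at bounded distance from each other. -/
def AreClose {X Y : Type*} (dY : Y → Y → ℝ) (α β : X → Y) : Prop :=
  ∃ K : ℝ, ∀ x, dY (α x) (β x) ≤ K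

def IsPreCoarseHom {X Y : Type*} [Group X] [Group Y] (dY : Y → Y → ℝ) (α : X → Y) : Prop :=
  ∃ K : ℝ, ∀ x x', dY (α (x * x')) (α x * α x') ≤ K

def IsQIEmbedding {X Y : Type*} (dX : X → X → ℝ) (dY : Y → Y → ℝ) (α : X → Y) : Prop :=
  ∃ C₁ > (0 : ℝ), ∃ C₂ > (0 : ℝ), ∃ D₁ ≥ (0 : ℝ), ∃ D₂ ≥ (0 : ℝ), ∀ x x',
    C₁ * dX x x' - D₁ ≤ dY (α x) (α x') ∧ dY (α x) (α x') ≤ C₂ * dX x x' + D₂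

/-- `α` and `β` are controlled maps that are coarse inverse to each other. -/
structure AreCoarseInverse {X Y : Type*} (dX : X → X → ℝ) (dY : Y → Y → ℝ)
    (α : X → Y) (β : Y → X) : Prop where
  controlled_left : IsControlled dX dY α
  controlled_right : IsControlled dY dX β
  left : AreClose dX (β ∘ α) id
  right : AreClose dY (α ∘ β) id

/-- A quasi-isometry: a quasi-isometric embedding with a coarse inverse that is also a
quasi-isometric embedding. -/
def IsQuasiIsometry {X Y : Type*} (dX : X → X → ℝ) (dY : Y → Y → ℝ) (α : X → Y) : Prop :=
  IsQIEmbedding dX dY α ∧ ∃ β : Y → X, IsQIEmbedding dY dX β ∧ AreCoarseInverse dX dY α β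

/-- `(X, dX)` and `(Y, dY)` are groups with bi-invariant almost metrics, and `α`, `β` are coarse
homomorphisms that are coarse inverse to each other, so that `α` is an isomorphism of coarse groups
with inverse `β`. -/
structure IsCoarseGroupIso {X Y : Type*} [Group X] [Group Y] (dX : X → X → ℝ) (dY : Y → Y → ℝ)
    (α : X → Y) (β : Y → X) : Prop where
  almostMetric_source : IsBiinvariantAlmostMetric dX
  almostMetric_target : IsBiinvariantAlmostMetric dY
  preCoarseHom_left : IsPreCoarseHom dY α
  preCoarseHom_right : IsPreCoarseHom dX β
  coarseInverse : AreCoarseInverse dX dY α β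

/-! ### The group `ℤ^ℓ` and the two maps -/

/-- The group `ℤ^ℓ`, written multiplicatively. -/
abbrev ZGroup (ℓ : ℕ) : Type := Multiplicative (Fin ℓ → ℤ)

/-- The `i`-th coordinate of an element of `ℤ^ℓ`. -/
def ZGroup.coord {ℓ : ℕ} (m : ZGroup ℓ) (i : Fin ℓ) : ℤ := Multiplicative.toAdd m i

/-- The distance `‖m - n‖₁` on `ℤ^ℓ`. -/
def l1Dist (ℓ : ℕ) (m n : ZGroup ℓ) : ℝ := ∑ i, |(m.coord i : ℝ) - (n.coord i : ℝ)|

/-- `ρ : ℝ^ℓ → ℤ^ℓ` satisfies `sup_u ‖u - ρ(u)‖₁ < ∞`. -/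
def IsRounding {ℓ : ℕ} (ρ : (Fin ℓ → ℝ) → ZGroup ℓ) : Prop :=
  ∃ K : ℝ, ∀ u : Fin ℓ → ℝ, ∑ i, |u i - ((ρ u).coord i : ℝ)| ≤ K

/-- The value of `ν : N → ℝ` at an element of `[G,N] ≤ N`. -/
def evalAt {G : Type*} [Group G] {N : Subgroup G} [N.Normal] (ν : invQuasimorphisms N)
    (y : mixedCommutator N) : ℝ :=
  (ν : N → ℝ) (Subgroup.inclusion (Subgroup.commutator_le_right ⊤ N) y)

/-- The evaluation map `y ↦ (ν₁(y), …, ν_ℓ(y))`. -/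
def evalMap {G : Type*} [Group G] {N : Subgroup G} [N.Normal] {ℓ : ℕ}
    (ν : Fin ℓ → invQuasimorphisms N) (y : mixedCommutator N) : Fin ℓ → ℝ :=
  fun j => evalAt (ν j) y

/-- The map `(m₁, …, m_ℓ) ↦ y₁^{m₁} ⋯ y_ℓ^{m_ℓ}`, the product in this order. -/
def powerMap {G : Type*} [Group G] {N : Subgroup G} {ℓ : ℕ}
    (y : Fin ℓ → mixedCommutator N) (m : ZGroup ℓ) : mixedCommutator N :=
  (List.ofFn fun i => y i ^ m.coord i).prod

/-- `ν_j(y_i) = δ_{ij}` for all `i`, `j`. -/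
def IsDualPair {G : Type*} [Group G] {N : Subgroup G} [N.Normal] {ℓ : ℕ}
    (ν : Fin ℓ → invQuasimorphisms N) (y : Fin ℓ → mixedCommutator N) : Prop :=
  ∀ i j, evalAt (ν j) (y i) = if i = j then 1 else 0

/-- The coordinatewise floor map is a rounding map. -/
theorem isRounding_floor (ℓ : ℕ) :
    IsRounding (fun u : Fin ℓ → ℝ => Multiplicative.ofAdd fun i => ⌊u i⌋) := by
  refine ⟨∑ _i : Fin ℓ, 1, fun u => Finset.sum_le_sum fun i _ => ?_⟩
  change |u i - (⌊u i⌋ : ℝ)| ≤ 1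
  rw [abs_le]
  constructor
  · linarith [Int.floor_le (u i)]
  · linarith [Int.lt_floor_add_one (u i)]

end

/-!
The metric `d_scl` on `[G,N]` is compared with the `ℓ¹`-metric of `ℝ^ℓ` through the map
`(ν₁, …, ν_ℓ) : [G,N] → ℝ^ℓ`: by `IsDualPair.exists_comparison`, the distances `d_scl(a, b)` and
`∑ⱼ |νⱼ(a) - νⱼ(b)|` bound each other up to multiplicative and additive constants. As `σ` and `τ`
change the coordinates `(ν₁, …, ν_ℓ)` by a bounded amount only, all coarse statements follow from
this comparison by the triangle inequality in `ℝ^ℓ` (`IsDualPair.coarse_equivalence`).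

That `|ν(z)|` is bounded by a multiple of `scl(z)` is the easy direction of Bavard duality: an
invariant quasimorphism is bounded by its defect on simple commutators
(`exists_abs_evalAt_le_mixedScl`).

For the opposite bound, let `∂(x, z) = [xz] - [x] - [z]`, a real chain on the set of orbits of `G`
on `N`. Invariant quasimorphisms of defect at most `1` are the linear forms on such chains that are
at most `1` in absolute value on all `∂(x, z)`. By the Hahn–Banach theorem
(`exists_invariant_quasimorphism`), the supremum of their values at `z ∈ [G,N]` is the infimum
of the `ℓ¹`-norms of the real `2`-chains filling `[z]`. Conversely, such a filling bounds `scl(z)`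
(`mixedScl_le_of_boundary_eq`): simultaneous Diophantine approximation of its coefficients gives an
integral filling of a multiple `k[z]` at nearly `k` times the cost, and this filling says that two
words in `N` whose products differ by `zᵏ` consist of the same letters up to order and conjugation;
so `zᵏ` is a product of at most two simple commutators for each letter. After homogenization
(`exists_homogenization`), `scl(z) ≤ 4 |Φ(z)| + 10` for some `Φ ∈ Q(N)^G` of defect at most `4`.
Finally `Φ = ∑ᵢ Φ(yᵢ) νᵢ` on `[G,N]`, and the easy direction bounds the coefficients `Φ(yᵢ)` by
`8 cl(yᵢ)`, uniformly in `Φ`.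

Dual families exist because an invariant homogeneous quasimorphism that vanishes on `[G,N]` is a
homomorphism (`mem_invHomomorphisms_of_evalAt_eq_zero`), so that the evaluations at the elements of
`[G,N]` span the dual of `Q(N)^G / H¹(N)^G`.
-/

/-! ### Mixed commutator length -/

section CommutatorLength

variable {G : Type*} [Group G] {N : Subgroup G}

theorem zero_mem_commutatorLengths_one : 0 ∈ commutatorLengths N (1 : G) :=
  ⟨[], rfl, by simp, rfl⟩

theorem mem_commutatorLengths_mul {m n : ℕ} {a b : G} (ha : m ∈ commutatorLengths N a)
    (hb : n ∈ commutatorLengths N b) : m + n ∈ commutatorLengths N (a * b) := by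
  obtain ⟨l, rfl, hc, rfl⟩ := ha
  obtain ⟨l', rfl, hc', rfl⟩ := hb
  exact ⟨l ++ l', by simp, fun c h => (List.mem_append.1 h).elim (hc c) (hc' c), by simp⟩

theorem one_mem_commutatorLengths (g : G) {x : G} (hx : x ∈ N) :
    1 ∈ commutatorLengths N (g * x * g⁻¹ * x⁻¹) :=
  ⟨[_], rfl, by simpa using ⟨g, x, hx, rfl⟩, by simp⟩

theorem mixedCl_le {y : mixedCommutator N} {n : ℕ} (h : n ∈ commutatorLengths N (y : G)) :
    mixedCl N y ≤ n :=
  Nat.sInf_le h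

theorem mixedCl_one : mixedCl N 1 = 0 :=
  Nat.le_zero.1 (mixedCl_le zero_mem_commutatorLengths_one)

variable [hN : N.Normal]

theorem IsSimpleCommutator.conj {c : G} (h : IsSimpleCommutator N c) (a : G) :
    IsSimpleCommutator N (a * c * a⁻¹) := by
  obtain ⟨g, x, hx, rfl⟩ := h
  exact ⟨a * g * a⁻¹, a * x * a⁻¹, hN.conj_mem x hx a, by group⟩

theorem mem_commutatorLengths_conj {n : ℕ} {b : G} (h : n ∈ commutatorLengths N b) (a : G) :
    n ∈ commutatorLengths N (a * b * a⁻¹) := by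
  obtain ⟨l, rfl, hc, rfl⟩ := h
  refine ⟨l.map (MulAut.conj a), by simp, fun c h => ?_, ?_⟩
  · obtain ⟨d, hd, rfl⟩ := List.mem_map.1 h
    exact (hc d hd).conj a
  · rw [← map_list_prod, MulAut.conj_apply]

theorem mem_commutatorLengths_inv {n : ℕ} {b : G} (h : n ∈ commutatorLengths N b) :
    n ∈ commutatorLengths N b⁻¹ := by
  obtain ⟨l, rfl, hc, rfl⟩ := h
  refine ⟨(l.map fun c => c⁻¹).reverse, by simp, fun c h => ?_, ?_⟩
  · obtain ⟨d, hd, rfl⟩ := List.mem_map.1 (List.mem_reverse.1 h)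
    exact (hc d hd).inv
  · rw [List.prod_inv_reverse]

theorem mixedCl_mem (y : mixedCommutator N) : mixedCl N y ∈ commutatorLengths N (y : G) :=
  Nat.sInf_mem (commutatorLengths_nonempty N y)

theorem mixedCl_inv (y : mixedCommutator N) : mixedCl N y⁻¹ = mixedCl N y := by
  refine le_antisymm (mixedCl_le (mem_commutatorLengths_inv (mixedCl_mem y))) ?_
  simpa using mixedCl_le (y := y⁻¹⁻¹) (mem_commutatorLengths_inv (mixedCl_mem y⁻¹))

theorem mixedCl_conj (a y : mixedCommutator N) : mixedCl N (a * y * a⁻¹) = mixedCl N y := by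
  have h : ∀ a y : mixedCommutator N, mixedCl N (a * y * a⁻¹) ≤ mixedCl N y := fun a y =>
    mixedCl_le (mem_commutatorLengths_conj (mixedCl_mem y) a)
  refine le_antisymm (h a y) ?_
  simpa [mul_assoc] using h a⁻¹ (a * y * a⁻¹)

theorem mixedCl_pow_le (y : mixedCommutator N) (n : ℕ) : mixedCl N (y ^ n) ≤ n * mixedCl N y := by
  induction n with
  | zero => simp [mixedCl_one]
  | succ n ih =>
    rw [pow_succ, add_mul, one_mul]
    exact (mixedCl_mul_le N _ _).trans (by gcongr)

theorem mixedCl_zpow_le (y : mixedCommutator N) (n : ℤ) :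
    (mixedCl N (y ^ n) : ℝ) ≤ |(n : ℝ)| * mixedCl N y := by
  have h : mixedCl N (y ^ n) ≤ n.natAbs * mixedCl N y := by
    obtain ⟨k, rfl | rfl⟩ := Int.eq_nat_or_neg n
    · simpa using mixedCl_pow_le y k
    · simpa [mixedCl_inv] using mixedCl_pow_le y k
  have h' : ((n.natAbs : ℕ) : ℝ) = |(n : ℝ)| := by rw [Nat.cast_natAbs, Int.cast_abs]
  rw [← h']
  exact_mod_cast h

theorem mixedScl_nonneg (y : mixedCommutator N) : 0 ≤ mixedScl N y :=
  ge_of_tendsto' (tendsto_mixedScl N y) fun n => by positivity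

theorem mixedScl_le_div (y : mixedCommutator N) {n : ℕ} (hn : n ≠ 0) :
    mixedScl N y ≤ (mixedCl N (y ^ n) : ℝ) / n := by
  have hs : Subadditive fun n : ℕ => (mixedCl N (y ^ n) : ℝ) := fun m n => by
    simp only [pow_add]
    exact_mod_cast mixedCl_mul_le N (y ^ m) (y ^ n)
  have hb : BddBelow (Set.range fun n : ℕ => (mixedCl N (y ^ n) : ℝ) / n) :=
    ⟨0, by rintro _ ⟨n, rfl⟩; positivity⟩
  rw [tendsto_nhds_unique (tendsto_mixedScl N y) (hs.tendsto_lim hb)]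
  exact hs.lim_le_div hb hn

theorem mixedScl_le_mixedCl (y : mixedCommutator N) : mixedScl N y ≤ mixedCl N y := by
  simpa using mixedScl_le_div y one_ne_zero

theorem mixedScl_one : mixedScl N 1 = 0 :=
  le_antisymm (by simpa [mixedCl_one] using mixedScl_le_mixedCl (N := N) 1) (mixedScl_nonneg 1)

theorem mixedScl_inv (y : mixedCommutator N) : mixedScl N y⁻¹ = mixedScl N y :=
  tendsto_nhds_unique (tendsto_mixedScl N y⁻¹) <| by
    simpa only [inv_pow, mixedCl_inv] using tendsto_mixedScl N y

theorem mixedScl_conj (a y : mixedCommutator N) : mixedScl N (a * y * a⁻¹) = mixedScl N y :=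
  tendsto_nhds_unique (tendsto_mixedScl N _) <| by
    simpa only [conj_pow, mixedCl_conj] using tendsto_mixedScl N y

/-- `(yz)ⁿ` and `yⁿ zⁿ` differ by `n` simple commutators, since passing from `n` to `n + 1` only
requires moving one letter `z` past `yⁿ`. -/
theorem exists_mul_pow_eq (y z : G) (hy : y ∈ N) (n : ℕ) :
    ∃ w, n ∈ commutatorLengths N w ∧ (y * z) ^ n = w * (y ^ n * z ^ n) := by
  induction n with
  | zero => exact ⟨1, zero_mem_commutatorLengths_one, by simp⟩
  | succ n ih =>
    obtain ⟨w, hw, h⟩ := ih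
    refine ⟨(y * z) * w * (y * z)⁻¹ * (y * (z * y ^ n * z⁻¹ * (y ^ n)⁻¹) * y⁻¹),
      mem_commutatorLengths_mul (mem_commutatorLengths_conj hw _)
        (mem_commutatorLengths_conj (one_mem_commutatorLengths z (N.pow_mem hy n)) y), ?_⟩
    rw [pow_succ', h, pow_succ' y, pow_succ' z]
    group

theorem mixedScl_mul_le (y z : mixedCommutator N) :
    mixedScl N (y * z) ≤ mixedScl N y + mixedScl N z + 1 := by
  refine le_of_tendsto_of_tendsto (tendsto_mixedScl N (y * z))
    (((tendsto_mixedScl N y).add (tendsto_mixedScl N z)).add tendsto_const_nhds) ?_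
  filter_upwards [Filter.eventually_gt_atTop 0] with n hn
  have hn' : (0 : ℝ) < n := by exact_mod_cast hn
  obtain ⟨w, hw, h⟩ := exists_mul_pow_eq (N := N) (y : G) z
    (Subgroup.commutator_le_right ⊤ N y.2) n
  have hcl : mixedCl N ((y * z) ^ n) ≤ n + (mixedCl N (y ^ n) + mixedCl N (z ^ n)) := by
    refine mixedCl_le ?_
    have := mem_commutatorLengths_mul hw
      (mem_commutatorLengths_mul (mixedCl_mem (y ^ n)) (mixedCl_mem (z ^ n)))
    simpa [h] using this
  have hcl' : (mixedCl N ((y * z) ^ n) : ℝ) ≤ n + (mixedCl N (y ^ n) + mixedCl N (z ^ n)) := by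
    exact_mod_cast hcl
  rw [← add_div, div_add_one hn'.ne', div_le_div_iff_of_pos_right hn']
  linarith

/-- `d_scl` is symmetric, bi-invariant, and satisfies the triangle inequality up to `1`. -/
theorem isBiinvariantAlmostMetric_sclDist :
    IsBiinvariantAlmostMetric (sclDist N) where
  nonneg x y := mixedScl_nonneg _
  self x := by simp [sclDist, mixedScl_one]
  symm x y := by rw [sclDist, ← mixedScl_inv]; simp [sclDist]
  triangle := by
    refine ⟨1, fun x y z => ?_⟩
    have h := mixedScl_mul_le (x⁻¹ * y) (y⁻¹ * z)
    rwa [mul_assoc, mul_inv_cancel_left] at h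
  biinvariant a b x y := by
    rw [sclDist, sclDist, ← mixedScl_conj b⁻¹ (x⁻¹ * y)]
    congr 1
    group

/-- A product of powers is a homomorphism up to one simple commutator for each factor. -/
theorem exists_prod_ofFn_mul_eq {n : ℕ} (a b : Fin n → G) (ha : ∀ i, a i ∈ N)
    (hb : ∀ i, b i ∈ N) : ∃ w, n ∈ commutatorLengths N w ∧
      (List.ofFn fun i => a i * b i).prod = w * ((List.ofFn a).prod * (List.ofFn b).prod) := by
  induction n with
  | zero => exact ⟨1, zero_mem_commutatorLengths_one, by simp⟩
  | succ n ih =>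
    obtain ⟨w, hw, h⟩ := ih (fun i => a i.succ) (fun i => b i.succ) (fun i => ha _) (fun i => hb _)
    have hA : (List.ofFn fun i => a i.succ).prod ∈ N := by
      refine N.list_prod_mem fun x hx => ?_
      obtain ⟨i, rfl⟩ := List.mem_ofFn.1 hx
      exact ha _
    simp only [List.ofFn_succ, List.prod_cons, h]
    generalize (List.ofFn fun i => a i.succ).prod = A at hA
    generalize (List.ofFn fun i => b i.succ).prod = B
    refine ⟨(a 0 * b 0) * w * (a 0 * b 0)⁻¹ * (a 0 * (b 0 * A * (b 0)⁻¹ * A⁻¹) * (a 0)⁻¹),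
      mem_commutatorLengths_mul (mem_commutatorLengths_conj hw _)
        (mem_commutatorLengths_conj (one_mem_commutatorLengths (b 0) hA) (a 0)), ?_⟩
    group

end CommutatorLength

/-! ### Homogenization of quasimorphisms -/

section Homogenization

open Filter Topology

variable {H : Type*} [Group H]

theorem abs_map_pow_sub_le {φ : H → ℝ} {D : ℝ} (hD : ∀ a b, |φ (a * b) - φ a - φ b| ≤ D)
    (x : H) (n : ℕ) : |φ (x ^ n) - n * φ x| ≤ (n + 1) * D := by
  induction n with
  | zero =>
    have h := hD 1 1
    simp only [mul_one, sub_self, zero_sub, abs_neg] at h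
    simpa using h
  | succ n ih =>
    have h := hD (x ^ n) x
    rw [← pow_succ] at h
    rw [abs_le] at h ih ⊢
    push_cast
    constructor <;> linarith [h.1, h.2, ih.1, ih.2]

theorem exists_tendsto_map_pow_div {φ : H → ℝ} {D : ℝ} (hD : ∀ a b, |φ (a * b) - φ a - φ b| ≤ D)
    (x : H) : ∃ c, Tendsto (fun n : ℕ => φ (x ^ n) / n) atTop (𝓝 c) := by
  have hD0 : 0 ≤ D := (abs_nonneg _).trans (hD 1 1)
  have hs : Subadditive fun n : ℕ => φ (x ^ n) + D := fun m n => by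
    have h := (abs_le.1 (hD (x ^ m) (x ^ n))).2
    rw [← pow_add] at h
    linarith
  have hb : BddBelow (Set.range fun n : ℕ => (φ (x ^ n) + D) / n) := by
    refine ⟨-|φ x| - D, ?_⟩
    rintro _ ⟨n, rfl⟩
    rcases Nat.eq_zero_or_pos n with rfl | hn
    · simp only [Nat.cast_zero, div_zero]
      linarith [abs_nonneg (φ x)]
    · have hn' : (0 : ℝ) < n := by exact_mod_cast hn
      dsimp only
      rw [le_div_iff₀ hn']
      have h := (abs_le.1 (abs_map_pow_sub_le hD x n)).1
      have h' := mul_le_mul_of_nonneg_left (neg_abs_le (φ x)) hn'.le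
      nlinarith
  refine ⟨hs.lim, ?_⟩
  have h := (hs.tendsto_lim hb).sub (tendsto_const_div_atTop_nhds_zero_nat D)
  rw [sub_zero] at h
  refine h.congr fun n => ?_
  ring

/-- Homogenization: a quasimorphism `φ` of defect at most `D` is at distance at most `D` from the
homogeneous quasimorphism `x ↦ lim φ(xⁿ)/n`. Every symmetry of `φ` that commutes with taking
powers is inherited by the limit; here this is recorded for automorphisms of `H`. -/
theorem exists_homogenization {φ : H → ℝ} {D : ℝ} (hD : ∀ a b, |φ (a * b) - φ a - φ b| ≤ D) :
    ∃ Φ : H → ℝ, IsHomogeneous Φ ∧ (∀ x, |Φ x - φ x| ≤ D) ∧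
      ∀ f : MulAut H, (∀ x, φ (f x) = φ x) → ∀ x, Φ (f x) = Φ x := by
  choose Φ hΦ using exists_tendsto_map_pow_div hD
  have hpow : ∀ (x : H) (k : ℕ), Φ (x ^ k) = k * Φ x := by
    intro x k
    rcases Nat.eq_zero_or_pos k with rfl | hk
    · have h : Tendsto (fun n : ℕ => φ ((x ^ 0) ^ n) / n) atTop (𝓝 0) := by
        simpa using tendsto_const_div_atTop_nhds_zero_nat (φ 1)
      simpa using tendsto_nhds_unique (hΦ _) h
    · refine tendsto_nhds_unique (hΦ _) ?_
      have h := ((hΦ x).comp (tendsto_id.const_mul_atTop' hk)).const_mul (k : ℝ)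
      refine h.congr fun n => ?_
      have hk' : (k : ℝ) ≠ 0 := by positivity
      simp only [Function.comp_apply, id, Nat.cast_mul, pow_mul]
      field_simp
  have hinv : ∀ x, Φ x⁻¹ = -Φ x := by
    intro x
    have h : Tendsto (fun n : ℕ => φ (x⁻¹ ^ n) / n + φ (x ^ n) / n) atTop (𝓝 0) := by
      refine squeeze_zero_norm (a := fun n : ℕ => (|φ 1| + D) / n) (fun n => ?_)
        (tendsto_const_div_atTop_nhds_zero_nat _)
      have h1 := hD (x⁻¹ ^ n) (x ^ n)
      rw [inv_pow, inv_mul_cancel] at h1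
      rw [Real.norm_eq_abs, ← add_div, abs_div, Nat.abs_cast, inv_pow]
      gcongr
      rw [abs_le] at h1 ⊢
      constructor <;> linarith [h1.1, h1.2, le_abs_self (φ 1), neg_abs_le (φ 1)]
    linarith [tendsto_nhds_unique h ((hΦ x⁻¹).add (hΦ x))]
  refine ⟨Φ, fun x n => ?_, fun x => ?_, fun f hf x => ?_⟩
  · obtain ⟨k, rfl | rfl⟩ := Int.eq_nat_or_neg n
    · simpa using hpow x k
    · simp [hinv, hpow]
  · refine le_of_tendsto_of_tendsto (((hΦ x).sub_const (φ x)).abs)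
      (f := fun n : ℕ => |φ (x ^ n) / n - φ x|) (g := fun n : ℕ => D + D / n) ?_ ?_
    · simpa using tendsto_const_nhds.add (tendsto_const_div_atTop_nhds_zero_nat D)
    · filter_upwards [eventually_gt_atTop 0] with n hn
      have hn' : (0 : ℝ) < n := by exact_mod_cast hn
      have h := abs_map_pow_sub_le hD x n
      have h2 : φ (x ^ n) / n - φ x = (φ (x ^ n) - n * φ x) / n := by field_simp
      rw [h2, abs_div, Nat.abs_cast, div_le_iff₀ hn']
      refine h.trans (le_of_eq ?_)
      field_simp
  · refine tendsto_nhds_unique (hΦ (f x)) ((hΦ x).congr fun n => ?_)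
    rw [← map_pow, hf]

end Homogenization

/-! ### Invariant homogeneous quasimorphisms -/

section InvQuasimorphisms

variable {G : Type*} [Group G] {N : Subgroup G} [hN : N.Normal]

/-- An invariant quasimorphism of defect at most `D` has absolute value at most `2nD` on products
of `n` simple commutators: on `g x g⁻¹ · x⁻¹` the two factors cancel up to the defect. -/
theorem abs_le_of_mem_commutatorLengths {ν : N → ℝ} {D : ℝ}
    (hD : ∀ a b, |ν (a * b) - ν a - ν b| ≤ D) (hhom : IsHomogeneous ν)
    (hinv : IsConjInvariant N ν) {n : ℕ} (x : N) (hx : n ∈ commutatorLengths N (x : G)) :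
    |ν x| ≤ 2 * D * n := by
  have hν1 : ν 1 = 0 := by simpa using hhom 1 0
  obtain ⟨l, rfl, hc, hl⟩ := hx
  induction l generalizing x with
  | nil =>
    have : x = 1 := by ext; simpa using hl.symm
    simp [this, hν1]
  | cons c l ih =>
    obtain ⟨g, z, hz, hgz⟩ := hc c (by simp)
    set z' : N := ⟨z, hz⟩
    have hx : x = MulAut.conjNormal g z' * z'⁻¹ * ((MulAut.conjNormal g z' * z'⁻¹)⁻¹ * x) := by
      group
    have h1 := ih ((MulAut.conjNormal g z' * z'⁻¹)⁻¹ * x) (fun c hc' => hc c (by simp [hc'])) (by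
      simp [z', ← hl, ← hgz, mul_assoc])
    have h2 := hD (MulAut.conjNormal g z' * z'⁻¹) ((MulAut.conjNormal g z' * z'⁻¹)⁻¹ * x)
    rw [← hx] at h2
    have h3 := hD (MulAut.conjNormal g z') z'⁻¹
    have h4 : ν z'⁻¹ = -ν z' := by simpa using hhom z' (-1)
    rw [hinv, h4] at h3
    rw [abs_le] at h1 h2 h3 ⊢
    push_cast [List.length_cons]
    constructor <;> linarith [h1.1, h1.2, h2.1, h2.2, h3.1, h3.2]

theorem evalAt_pow (ν : invQuasimorphisms N) (y : mixedCommutator N) (n : ℤ) :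
    evalAt ν (y ^ n) = n * evalAt ν y := by
  rw [evalAt, map_zpow]
  exact ν.2.2.1 _ n

theorem evalAt_one (ν : invQuasimorphisms N) : evalAt ν 1 = 0 := by
  simpa using evalAt_pow ν 1 0

theorem evalAt_inv (ν : invQuasimorphisms N) (y : mixedCommutator N) :
    evalAt ν y⁻¹ = -evalAt ν y := by
  simpa using evalAt_pow ν y (-1)

theorem exists_abs_evalAt_mul_sub_le (ν : invQuasimorphisms N) :
    ∃ D, 0 ≤ D ∧ ∀ y z, |evalAt ν (y * z) - evalAt ν y - evalAt ν z| ≤ D := by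
  obtain ⟨D, hD⟩ := ν.2.1
  refine ⟨D, (abs_nonneg _).trans (hD 1 1), fun y z => ?_⟩
  rw [evalAt, map_mul]
  exact hD _ _

theorem abs_evalAt_le_mixedCl (ν : invQuasimorphisms N) {D : ℝ}
    (hD : ∀ a b, |(ν : N → ℝ) (a * b) - (ν : N → ℝ) a - (ν : N → ℝ) b| ≤ D)
    (y : mixedCommutator N) : |evalAt ν y| ≤ 2 * D * mixedCl N y :=
  abs_le_of_mem_commutatorLengths hD ν.2.2.1 ν.2.2.2 _ (mixedCl_mem y)

/-- The easy direction of Bavard duality. -/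
theorem exists_abs_evalAt_le_mixedScl (ν : invQuasimorphisms N) :
    ∃ C, 0 ≤ C ∧ ∀ y, |evalAt ν y| ≤ C * mixedScl N y := by
  obtain ⟨D, hD⟩ := ν.2.1
  have hD0 : 0 ≤ D := (abs_nonneg _).trans (hD 1 1)
  refine ⟨2 * D, by positivity, fun y => ?_⟩
  refine ge_of_tendsto ((tendsto_mixedScl N y).const_mul (2 * D)) ?_
  filter_upwards [Filter.eventually_gt_atTop 0] with n hn
  have hn' : (0 : ℝ) < n := by exact_mod_cast hn
  have h := abs_evalAt_le_mixedCl ν hD (y ^ n)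
  have h2 : evalAt ν (y ^ n) = n * evalAt ν y := by simpa using evalAt_pow ν y n
  rw [h2, abs_mul, Nat.abs_cast] at h
  rw [← mul_div_assoc, le_div_iff₀ hn']
  linarith

/-- Invariant homomorphisms vanish on `[G,N]`. -/
theorem evalAt_eq_zero_of_mem (ν : invQuasimorphisms N) (h : (ν : N → ℝ) ∈ invHomomorphisms N)
    (y : mixedCommutator N) : evalAt ν y = 0 := by
  have h := abs_evalAt_le_mixedCl ν (D := 0) (fun a b => by simp [h.1 a b]) y
  simpa using h

/-- An invariant homogeneous quasimorphism vanishing on `[G,N]` is a homomorphism, because `(xz)ⁿ`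
and `xⁿ zⁿ` differ by an element of `[G,N]` and the defect is negligible after division by `n`. -/
theorem mem_invHomomorphisms_of_evalAt_eq_zero (ν : invQuasimorphisms N)
    (h : ∀ y, evalAt ν y = 0) : (ν : N → ℝ) ∈ invHomomorphisms N := by
  refine ⟨fun x z => ?_, ν.2.2.2⟩
  obtain ⟨D, hD⟩ := ν.2.1
  have hn : ∀ n : ℕ, (n : ℝ) * |(ν : N → ℝ) (x * z) - (ν : N → ℝ) x - (ν : N → ℝ) z| ≤ 2 * D := by
    intro n
    obtain ⟨w, hw, hwe⟩ := exists_mul_pow_eq (N := N) (x : G) z x.2 n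
    have hwm : w ∈ mixedCommutator N := by
      obtain ⟨l, -, hc, rfl⟩ := hw
      refine Subgroup.list_prod_mem _ fun c hc' => ?_
      obtain ⟨g, u, hu, rfl⟩ := hc c hc'
      exact Subgroup.commutator_mem_commutator (Subgroup.mem_top g) hu
    set w' : N := Subgroup.inclusion (Subgroup.commutator_le_right ⊤ N) ⟨w, hwm⟩
    have hw0 : (ν : N → ℝ) w' = 0 := h ⟨w, hwm⟩
    have he : (x * z) ^ n = w' * (x ^ n * z ^ n) := by
      ext; simpa [w'] using hwe
    have h1 := hD w' (x ^ n * z ^ n)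
    have h2 := hD (x ^ n) (z ^ n)
    have hp : ∀ u : N, (ν : N → ℝ) (u ^ n) = n * (ν : N → ℝ) u := fun u => by
      simpa using ν.2.2.1 u n
    rw [← he, hw0, hp] at h1
    rw [hp, hp] at h2
    rw [← Nat.abs_cast, ← abs_mul]
    rw [abs_le] at h1 h2 ⊢
    constructor <;> linarith [h1.1, h1.2, h2.1, h2.2]
  -- a nonzero error would outgrow the bound `2 * D`
  by_contra hne
  have hpos : 0 < |(ν : N → ℝ) (x * z) - (ν : N → ℝ) x - (ν : N → ℝ) z| :=
    abs_pos.2 fun h0 => hne (by linarith)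
  obtain ⟨n, hn'⟩ := exists_nat_gt (2 * D / |(ν : N → ℝ) (x * z) - (ν : N → ℝ) x - (ν : N → ℝ) z|)
  rw [div_lt_iff₀ hpos] at hn'
  exact absurd (hn n) (not_le.2 hn')

end InvQuasimorphisms

/-! ### Simultaneous Diophantine approximation -/

/-- Finitely many real numbers have integer multiples, by a common positive factor, that are
arbitrarily close to integers: by compactness, two of the points `(Int.fract (n aᵢ))ᵢ` of the unit
cube are close to each other. -/
theorem exists_nat_mul_near_int {ι : Type*} [Finite ι] (a : ι → ℝ) {ε : ℝ} (hε : 0 < ε) :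
    ∃ k : ℕ, 0 < k ∧ ∃ c : ι → ℤ, ∀ i, |k * a i - c i| < ε := by
  have := Fintype.ofFinite ι
  obtain ⟨x, -, φ, hφ, hx⟩ := (isCompact_Icc (a := (0 : ι → ℝ)) (b := 1)).tendsto_subseq
    (x := fun n : ℕ => fun i => Int.fract (n * a i))
    (fun n => ⟨fun i => Int.fract_nonneg _, fun i => (Int.fract_lt_one _).le⟩)
  obtain ⟨M, hM⟩ := Metric.cauchySeq_iff.1 hx.cauchySeq ε hε
  have hlt : φ M < φ (M + 1) := hφ (Nat.lt_succ_self M)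
  refine ⟨φ (M + 1) - φ M, Nat.sub_pos_of_lt hlt,
    fun i => ⌊(φ (M + 1) : ℝ) * a i⌋ - ⌊(φ M : ℝ) * a i⌋, fun i => ?_⟩
  have h := (dist_le_pi_dist _ _ i).trans_lt (hM (M + 1) (Nat.le_succ M) M le_rfl)
  rw [Real.dist_eq] at h
  simp only [Function.comp_apply, Int.fract] at h
  rw [Nat.cast_sub hlt.le]
  push_cast
  refine lt_of_eq_of_lt (congrArg abs ?_) h
  ring

/-! ### Chains of conjugacy classes -/

section Chains

variable {G : Type*} [Group G]

/-- The set of orbits of `G` acting on the normal subgroup `N` by conjugation. -/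
abbrev ConjOrbits (N : Subgroup G) [N.Normal] : Type _ :=
  Quotient
    { r := fun x y : N => ∃ g : G, MulAut.conjNormal g x = y
      iseqv :=
        ⟨fun _ => ⟨1, by simp⟩, fun ⟨g, h⟩ => ⟨g⁻¹, by simp [← h]⟩,
          fun ⟨g, h⟩ ⟨g', h'⟩ => ⟨g' * g, by simp [← h', ← h]⟩⟩ : Setoid N }

/-- The orbit `[x]` of `x`, as a basis vector of the real vector space on the orbits. -/
noncomputable def orbitChain {N : Subgroup G} [N.Normal] (x : N) : ConjOrbits N →₀ ℝ :=
  Finsupp.single (Quotient.mk _ x) 1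

/-- The boundary map `(x, z) ↦ [xz] - [x] - [z]` on real `2`-chains. -/
noncomputable def boundary (N : Subgroup G) [N.Normal] : (N × N →₀ ℝ) →ₗ[ℝ] (ConjOrbits N →₀ ℝ) :=
  Finsupp.linearCombination ℝ fun p : N × N =>
    orbitChain (p.1 * p.2) - orbitChain p.1 - orbitChain p.2

/-- The `ℓ¹`-norm of a `2`-chain. -/
def chainNorm {ι : Type*} (a : ι →₀ ℝ) : ℝ := a.sum fun _ t => |t|

theorem chainNorm_nonneg {ι : Type*} (a : ι →₀ ℝ) : 0 ≤ chainNorm a :=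
  Finset.sum_nonneg fun _ _ => abs_nonneg _

theorem chainNorm_eq_sum {ι : Type*} (a : ι →₀ ℝ) {s : Finset ι} (h : a.support ⊆ s) :
    chainNorm a = ∑ i ∈ s, |a i| :=
  Finsupp.sum_of_support_subset a h _ (by simp)

theorem chainNorm_add_le {ι : Type*} (a b : ι →₀ ℝ) :
    chainNorm (a + b) ≤ chainNorm a + chainNorm b := by
  classical
  rw [chainNorm_eq_sum _ Finsupp.support_add, chainNorm_eq_sum a Finset.subset_union_left,
    chainNorm_eq_sum b Finset.subset_union_right, ← Finset.sum_add_distrib]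
  exact Finset.sum_le_sum fun i _ => abs_add_le _ _

theorem chainNorm_smul {ι : Type*} (c : ℝ) (a : ι →₀ ℝ) :
    chainNorm (c • a) = |c| * chainNorm a := by
  rw [chainNorm_eq_sum _ Finsupp.support_smul, chainNorm_eq_sum a subset_rfl, Finset.mul_sum]
  exact Finset.sum_congr rfl fun i _ => by simp [abs_mul]

variable {N : Subgroup G} [hN : N.Normal]

theorem orbitChain_conj (g : G) (x : N) : orbitChain (MulAut.conjNormal g x) = orbitChain x := by
  rw [orbitChain, orbitChain]
  congr 1
  exact Quotient.sound (show ∃ h : G, _ from ⟨g⁻¹, by simp⟩)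

theorem boundary_single (x z : N) : boundary N (Finsupp.single (x, z) 1)
    = orbitChain (x * z) - orbitChain x - orbitChain z := by
  simp [boundary]

/-- Two lists of elements of `N` that agree up to order and conjugation by `G` have products that
differ by two simple commutators for each letter: one to conjugate it, one to move it. -/
theorem mem_commutatorLengths_of_perm (l l' : List N)
    (h : (l.map (Quotient.mk _ : N → ConjOrbits N)).Perm (l'.map (Quotient.mk _))) :
    2 * l.length ∈ commutatorLengths N ((l.prod * l'.prod⁻¹ : N) : G) := by
  induction l generalizing l' with
  | nil =>
    have : l' = [] := by simpa using h
    subst this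
    simpa using zero_mem_commutatorLengths_one
  | cons x t ih =>
    have hx : (Quotient.mk _ x : ConjOrbits N) ∈ l'.map (Quotient.mk _) :=
      h.subset (by simp)
    obtain ⟨x', hx', hxx'⟩ := List.mem_map.1 hx
    obtain ⟨A, B, rfl⟩ := List.append_of_mem hx'
    obtain ⟨g, hg⟩ : ∃ g : G, MulAut.conjNormal g x' = x := Quotient.exact hxx'
    have hperm : (t.map (Quotient.mk _ : N → ConjOrbits N)).Perm ((A ++ B).map (Quotient.mk _)) := by
      have h2 := h.trans (List.perm_middle.map _)
      rw [List.map_cons, List.map_cons, hxx'] at h2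
      exact h2.cons_inv
    have h1 := mem_commutatorLengths_conj (ih _ hperm) (x : G)
    have h2 := one_mem_commutatorLengths (N := N) g x'.2
    have h3 := one_mem_commutatorLengths (N := N) (x' : G) A.prod.2
    have h4 := mem_commutatorLengths_mul (mem_commutatorLengths_mul h1 h2) h3
    have hg' : g * x' * g⁻¹ = (x : G) := by simpa using congrArg Subtype.val hg
    rw [hg'] at h4
    refine (congrArg₂ (fun (n : ℕ) (z : G) => n ∈ commutatorLengths N z) ?_ ?_).mp h4
    · simp only [List.length_cons]; ring
    · simp only [List.prod_cons, List.prod_append, Subgroup.coe_mul, Subgroup.coe_inv]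
      group

theorem sum_orbitChain_apply [DecidableEq (ConjOrbits N)] (l : List N) (q : ConjOrbits N) :
    (l.map orbitChain).sum q = ((l.map (Quotient.mk _ : N → ConjOrbits N)).count q : ℝ) := by
  induction l with
  | nil => simp
  | cons x t ih =>
    rw [List.map_cons, List.sum_cons, Finsupp.add_apply, ih, List.map_cons, List.count_cons,
      orbitChain, Finsupp.single_apply]
    by_cases hq : (Quotient.mk _ x : ConjOrbits N) = q
    · simp [hq, add_comm]
    · simp [hq]

theorem perm_of_sum_orbitChain_eq {l l' : List N}
    (h : (l.map orbitChain).sum = (l'.map orbitChain).sum) :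
    (l.map (Quotient.mk _ : N → ConjOrbits N)).Perm (l'.map (Quotient.mk _)) := by
  classical
  refine List.perm_iff_count.2 fun q => ?_
  have h' := DFunLike.congr_fun h q
  rw [sum_orbitChain_apply, sum_orbitChain_apply] at h'
  exact_mod_cast h'

/-- If `k[y]` is a signed sum of boundaries `[xz] - [x] - [z]`, with `(x, z)` running over `P` with
positive and over `M` with negative sign, then `yᵏ` is a product of `2(k + 2|P| + |M|)` simple commutators:
the relation says that two words with the same product up to `yᵏ` have the same letters. -/
theorem mem_commutatorLengths_pow_of_sum_boundary (k : ℕ) (y : N) (P M : List (N × N))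
    (h : (k : ℝ) • orbitChain y = (P.map fun p => boundary N (Finsupp.single p 1)).sum
      - (M.map fun p => boundary N (Finsupp.single p 1)).sum) :
    2 * (k + 2 * P.length + M.length) ∈ commutatorLengths N ((y ^ k : N) : G) := by
  have hsplit : ∀ L : List (N × N), (L.map fun p => boundary N (Finsupp.single p 1)).sum
      = ((L.map fun p => p.1 * p.2).map orbitChain).sum
        - ((L.flatMap fun p => [p.1, p.2]).map orbitChain).sum := by
    intro L
    induction L with
    | nil => simp
    | cons p L ih =>
      obtain ⟨x, z⟩ := p
      simp only [List.map_cons, List.sum_cons, ih, boundary_single, List.flatMap_cons,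
        List.map_append, List.sum_append, List.map_nil, List.sum_nil]
      abel
  have hprod : ∀ L : List (N × N), (L.flatMap fun p => [p.1, p.2]).prod
      = (L.map fun p => p.1 * p.2).prod := by
    intro L
    induction L with
    | nil => simp
    | cons p L ih => simp [ih, mul_assoc]
  have hlen : ∀ L : List (N × N), (L.flatMap fun p => [p.1, p.2]).length = 2 * L.length := by
    intro L
    induction L with
    | nil => simp
    | cons p L ih => simp [ih]; ring
  have hperm := perm_of_sum_orbitChain_eq
    (l := List.replicate k y ++ ((P.flatMap fun p => [p.1, p.2]) ++ M.map fun p => p.1 * p.2))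
    (l' := (P.map fun p => p.1 * p.2) ++ (M.flatMap fun p => [p.1, p.2])) (by
      rw [hsplit, hsplit, Nat.cast_smul_eq_nsmul] at h
      simp only [List.map_append, List.sum_append, List.map_replicate, List.sum_replicate, h]
      abel)
  have hmem := mem_commutatorLengths_of_perm _ _ hperm
  rw [List.prod_append, List.prod_append, List.prod_append, hprod, hprod, mul_inv_cancel_right,
    List.prod_replicate, List.length_append, List.length_append, hlen, List.length_replicate,
    List.length_map, ← add_assoc] at hmem
  exact hmem

/-- The coefficients of `∂(x, z)` are integers of absolute value at most `3`. -/
theorem exists_int_boundary_apply (p : N × N) (q : ConjOrbits N) :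
    ∃ m : ℤ, |m| ≤ 3 ∧ boundary N (Finsupp.single p 1) q = m := by
  classical
  have h : ∀ x : N, ∃ m : ℤ, |m| ≤ 1 ∧ orbitChain x q = m := by
    intro x
    rw [orbitChain, Finsupp.single_apply]
    split_ifs
    · exact ⟨1, by simp, by simp⟩
    · exact ⟨0, by simp, by simp⟩
  obtain ⟨x, z⟩ := p
  obtain ⟨m₁, h₁, e₁⟩ := h (x * z)
  obtain ⟨m₂, h₂, e₂⟩ := h x
  obtain ⟨m₃, h₃, e₃⟩ := h z
  refine ⟨m₁ - m₂ - m₃, ?_, ?_⟩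
  · rw [abs_le] at *
    omega
  · simp [boundary_single, e₁, e₂, e₃]

/-- A real filling of `[y]` can be replaced by an integral filling of some multiple `k[y]` at
almost `k` times the cost: the error of a good simultaneous approximation of the coefficients is
an integral chain with coefficients less than `1`, hence zero. -/
theorem exists_integral_filling (y : N) (a : N × N →₀ ℝ) (ha : boundary N a = orbitChain y) :
    ∃ k : ℕ, 0 < k ∧ ∃ c : N × N → ℤ,
      (k : ℝ) • orbitChain y = ∑ p ∈ a.support, (c p : ℝ) • boundary N (Finsupp.single p 1) ∧
      ∑ p ∈ a.support, |(c p : ℝ)| ≤ k * chainNorm a + 1 := by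
  classical
  set r : ℝ := (a.support.card : ℝ) with hr
  have hr0 : 0 ≤ r := by positivity
  have hε : 0 < 1 / (3 * r + 1) := by positivity
  obtain ⟨k, hk, c₀, hc₀⟩ := exists_nat_mul_near_int (fun p : a.support => a p) hε
  set c : N × N → ℤ := fun p => if h : p ∈ a.support then c₀ ⟨p, h⟩ else 0 with hc
  have hcp : ∀ p ∈ a.support, |k * a p - c p| ≤ 1 / (3 * r + 1) := by
    intro p hp
    have hcp : c p = c₀ ⟨p, hp⟩ := dif_pos hp
    rw [hcp]
    exact (hc₀ ⟨p, hp⟩).le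
  refine ⟨k, hk, c, ?_, ?_⟩
  · ext q
    have hbd : boundary N a = ∑ p ∈ a.support, a p • boundary N (Finsupp.single p 1) := by
      conv_lhs => rw [← Finsupp.sum_single a, Finsupp.sum, map_sum]
      refine Finset.sum_congr rfl fun p _ => ?_
      rw [← map_smul, Finsupp.smul_single, smul_eq_mul, mul_one]
    choose b hb3 hb using fun p => exists_int_boundary_apply (N := N) p q
    obtain ⟨e, he⟩ : ∃ e : ℤ, orbitChain y q = e := by
      rw [orbitChain, Finsupp.single_apply]
      split_ifs
      · exact ⟨1, by simp⟩
      · exact ⟨0, by simp⟩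
    have hbq : (e : ℝ) = ∑ p ∈ a.support, a p * b p := by
      rw [← he, ← ha, hbd]
      simp [Finsupp.finsetSum_apply, hb]
    have hlt : |(((k * e - ∑ p ∈ a.support, c p * b p : ℤ)) : ℝ)| < 1 := by
      push_cast
      rw [hbq, Finset.mul_sum, ← Finset.sum_sub_distrib]
      calc |∑ p ∈ a.support, (k * (a p * b p) - c p * b p)|
          ≤ ∑ p ∈ a.support, |k * (a p * b p) - c p * b p| := Finset.abs_sum_le_sum_abs _ _
        _ ≤ ∑ p ∈ a.support, 1 / (3 * r + 1) * 3 := by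
            refine Finset.sum_le_sum fun p hp => ?_
            rw [← mul_assoc, ← sub_mul, abs_mul]
            have h3 : |(b p : ℝ)| ≤ 3 := by exact_mod_cast hb3 p
            exact mul_le_mul (hcp p hp) h3 (abs_nonneg _) hε.le
        _ < 1 := by
            rw [Finset.sum_const, nsmul_eq_mul, ← hr, ← mul_assoc, mul_one_div, div_mul_eq_mul_div,
              div_lt_one (by positivity)]
            linarith
    have hzero : k * e - ∑ p ∈ a.support, c p * b p = 0 := by
      rw [← Int.abs_lt_one_iff]
      exact_mod_cast hlt
    have hzero' : (k : ℝ) * e - ∑ p ∈ a.support, (c p : ℝ) * b p = 0 := by exact_mod_cast hzero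
    simp only [Finsupp.smul_apply, Finsupp.finsetSum_apply, hb, he, smul_eq_mul]
    linarith
  · rw [chainNorm, Finsupp.sum, Finset.mul_sum]
    calc ∑ p ∈ a.support, |(c p : ℝ)|
        ≤ ∑ p ∈ a.support, (k * |a p| + 1 / (3 * r + 1)) := by
          refine Finset.sum_le_sum fun p hp => ?_
          have h := abs_sub_abs_le_abs_sub (c p : ℝ) (k * a p)
          rw [abs_sub_comm, abs_mul, Nat.abs_cast] at h
          linarith [hcp p hp]
      _ ≤ _ := by
          rw [Finset.sum_add_distrib, Finset.sum_const, nsmul_eq_mul, ← hr, mul_one_div]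
          gcongr
          rw [div_le_one (by positivity)]
          linarith

/-- The hard inequality behind Bavard duality: a real filling of `[y]` bounds `scl(y)`. -/
theorem mixedScl_le_of_boundary_eq (y : mixedCommutator N) (a : N × N →₀ ℝ)
    (ha : boundary N a
      = orbitChain (Subgroup.inclusion (Subgroup.commutator_le_right ⊤ N) y)) :
    mixedScl N y ≤ 4 * chainNorm a + 6 := by
  obtain ⟨k, hk, c, hc, hcn⟩ := exists_integral_filling _ a ha
  have hsum : ∀ d : N × N → ℕ,
      (((∑ p ∈ a.support, Multiset.replicate (d p) p).toList).map
        fun p => boundary N (Finsupp.single p 1)).sum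
      = ∑ p ∈ a.support, d p • boundary N (Finsupp.single p 1) := by
    intro d
    rw [← Multiset.sum_coe, ← Multiset.map_coe, Multiset.coe_toList]
    rw [← Multiset.coe_mapAddMonoidHom, ← Multiset.coe_sumAddMonoidHom, map_sum, map_sum]
    simp
  have hlen : ∀ d : N × N → ℕ,
      ((∑ p ∈ a.support, Multiset.replicate (d p) p).toList).length = ∑ p ∈ a.support, d p := by
    intro d
    simp
  have hmem := mem_commutatorLengths_pow_of_sum_boundary k
    (Subgroup.inclusion (Subgroup.commutator_le_right ⊤ N) y)
    (∑ p ∈ a.support, Multiset.replicate (c p).toNat p).toList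
    (∑ p ∈ a.support, Multiset.replicate (-c p).toNat p).toList (by
      rw [hsum, hsum, hc, ← Finset.sum_sub_distrib]
      refine Finset.sum_congr rfl fun p _ => ?_
      rw [← Nat.cast_smul_eq_nsmul ℝ, ← Nat.cast_smul_eq_nsmul ℝ, ← sub_smul]
      congr 1
      exact_mod_cast (Int.toNat_sub_toNat_neg (c p)).symm)
  rw [hlen, hlen] at hmem
  have hcl := mixedCl_le (y := y ^ k) hmem
  have hcl' : (mixedCl N (y ^ k) : ℝ) ≤ 2 * k + 4 * ∑ p ∈ a.support, |(c p : ℝ)| := by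
    have h1 : ∀ p, (((c p).toNat : ℕ) : ℝ) + (((-c p).toNat : ℕ) : ℝ) = |(c p : ℝ)| := by
      intro p
      have : (((c p).toNat : ℕ) : ℤ) + (((-c p).toNat : ℕ) : ℤ) = |c p| := by
        rw [abs_eq_max_neg]; omega
      exact_mod_cast this
    have h2 : (mixedCl N (y ^ k) : ℝ) ≤ 2 * (k + 2 * ∑ p ∈ a.support, (((c p).toNat : ℕ) : ℝ)
        + ∑ p ∈ a.support, (((-c p).toNat : ℕ) : ℝ)) := by exact_mod_cast hcl
    have h3 : 0 ≤ ∑ p ∈ a.support, (((-c p).toNat : ℕ) : ℝ) :=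
      Finset.sum_nonneg fun _ _ => by positivity
    rw [← Finset.sum_congr rfl fun p _ => h1 p, Finset.sum_add_distrib]
    linarith
  have hk1 : (1 : ℝ) ≤ k := by exact_mod_cast hk
  refine (mixedScl_le_div y hk.ne').trans ?_
  rw [div_le_iff₀ (by linarith)]
  nlinarith [chainNorm_nonneg a]

/-- Every element of `[G,N]` has a filling: modulo boundaries, `x ↦ [x]` is additive and invariant
under conjugation, so it kills simple commutators. -/
theorem exists_boundary_eq (y : mixedCommutator N) : ∃ a : N × N →₀ ℝ, boundary N a
    = orbitChain (Subgroup.inclusion (Subgroup.commutator_le_right ⊤ N) y) := by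
  have hmul : ∀ x z : N,
      orbitChain (x * z) - orbitChain x - orbitChain z ∈ LinearMap.range (boundary N) :=
    fun x z => ⟨_, boundary_single x z⟩
  have h1 : orbitChain (1 : N) ∈ LinearMap.range (boundary N) := by
    simpa using hmul 1 1
  obtain ⟨l, hl, hc, hp⟩ := mixedCl_mem y
  clear hl
  generalize hx : Subgroup.inclusion (Subgroup.commutator_le_right ⊤ N) y = x
  have hxp : l.prod = (x : G) := by rw [hp, ← hx]; rfl
  clear hx hp
  change orbitChain x ∈ LinearMap.range (boundary N)
  induction l generalizing x with
  | nil =>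
    have : x = 1 := by ext; simpa using hxp.symm
    rwa [this]
  | cons c l ih =>
    obtain ⟨g, z, hz, hgz⟩ := hc c (by simp)
    set z' : N := ⟨z, hz⟩
    set d : N := MulAut.conjNormal g z' * z'⁻¹
    have h2 := ih (fun c hc' => hc c (by simp [hc'])) (d⁻¹ * x) (by
      simp [d, z', ← hxp, ← hgz, mul_assoc])
    have h3 := hmul d (d⁻¹ * x)
    rw [mul_inv_cancel_left] at h3
    have h4 := hmul (MulAut.conjNormal g z') z'⁻¹
    have h5 := hmul z' z'⁻¹
    rw [mul_inv_cancel] at h5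
    rw [orbitChain_conj] at h4
    have h6 := add_mem (add_mem h3 h2) (sub_mem h4 (sub_mem h5 h1))
    convert h6 using 1
    abel

/-! ### Bavard duality -/

/-- Hahn–Banach: there are invariant quasimorphisms of defect at most `1` taking any nonnegative
value at `y` that does not exceed the filling norm of `[y]`. -/
theorem exists_invariant_quasimorphism (y : N) (hy : ∃ a, boundary N a = orbitChain y) {c : ℝ}
    (hc0 : 0 ≤ c) (hc : ∀ a, boundary N a = orbitChain y → c ≤ chainNorm a) :
    ∃ φ : N → ℝ, (∀ a b, |φ (a * b) - φ a - φ b| ≤ 1) ∧ IsConjInvariant N φ ∧ φ y = c := by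
  obtain ⟨x, hx⟩ := hy
  have hxk : x ∉ LinearMap.ker (boundary N) := by
    rw [LinearMap.mem_ker, hx, orbitChain]
    simp
  -- the linear form on `ker ∂ ⊕ ℝ x` that vanishes on `ker ∂` and takes the value `c` at `x`
  set f₀ : (N × N →₀ ℝ) →ₗ.[ℝ] ℝ := ⟨LinearMap.ker (boundary N), 0⟩ with hf₀
  set f := f₀.supSpanSingleton x c hxk with hf
  have hfapp : ∀ (z : N × N →₀ ℝ) (hz : z ∈ LinearMap.ker (boundary N)) (t : ℝ)
      (h : z + t • x ∈ f.domain), f ⟨z + t • x, h⟩ = t * c := by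
    intro z hz t h
    refine (LinearPMap.supSpanSingleton_apply_mk f₀ x c hxk z hz t).trans ?_
    have h0 : f₀ ⟨z, hz⟩ = 0 := rfl
    simp [h0]
  have hdom : ∀ z ∈ f.domain, ∃ w ∈ LinearMap.ker (boundary N), ∃ t : ℝ, z = w + t • x := by
    intro z hz
    rw [hf, LinearPMap.domain_supSpanSingleton] at hz
    obtain ⟨w, hw, u, hu, rfl⟩ := Submodule.mem_sup.1 hz
    obtain ⟨t, rfl⟩ := Submodule.mem_span_singleton.1 hu
    exact ⟨w, hw, t, rfl⟩
  obtain ⟨g, hgf, hgn⟩ := exists_extension_of_le_sublinear f chainNorm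
    (fun t ht a => by rw [chainNorm_smul, abs_of_pos ht]) chainNorm_add_le (by
      rintro ⟨z, hz⟩
      obtain ⟨w, hw, t, rfl⟩ := hdom z hz
      rw [hfapp w hw]
      rcases le_or_gt t 0 with ht | ht
      · exact (mul_nonpos_of_nonpos_of_nonneg ht hc0).trans (chainNorm_nonneg _)
      · have h := hc (t⁻¹ • w + x) (by
          rw [map_add, map_smul, LinearMap.mem_ker.1 hw, smul_zero, zero_add, hx])
        have h2 : w + t • x = t • (t⁻¹ • w + x) := by
          rw [smul_add, smul_inv_smul₀ ht.ne']
        change t * c ≤ chainNorm (w + t • x)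
        rw [h2, chainNorm_smul, abs_of_pos ht]
        gcongr)
  have hgx : g x = c := by
    have hmem : (0 : N × N →₀ ℝ) + (1 : ℝ) • x ∈ f.domain := by
      rw [hf, LinearPMap.domain_supSpanSingleton, zero_add, one_smul]
      exact Submodule.mem_sup_right (Submodule.mem_span_singleton_self x)
    have h := hgf ⟨_, hmem⟩
    rw [hfapp 0 (zero_mem _) 1] at h
    simpa using h
  have hgker : g ∈ (LinearMap.ker (boundary N)).dualAnnihilator := by
    rw [Submodule.mem_dualAnnihilator]
    intro w hw
    have hmem : w + (0 : ℝ) • x ∈ f.domain := by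
      rw [hf, LinearPMap.domain_supSpanSingleton, zero_smul, add_zero]
      exact Submodule.mem_sup_left hw
    have h := hgf ⟨_, hmem⟩
    rw [hfapp w hw 0] at h
    simpa using h
  rw [← LinearMap.range_dualMap_eq_dualAnnihilator_ker] at hgker
  -- the extension `g` vanishes on `ker ∂`, hence factors through `∂`
  obtain ⟨ψ, hψ⟩ := hgker
  have hψ' : ∀ a, ψ (boundary N a) = g a := fun a => by rw [← hψ]; rfl
  refine ⟨fun z => ψ (orbitChain z), fun a b => ?_, fun γ z => congrArg ψ (orbitChain_conj γ z), ?_⟩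
  · rw [← map_sub, ← map_sub, ← boundary_single, hψ']
    have hn : chainNorm (Finsupp.single (a, b) (1 : ℝ)) = 1 := by
      simp [chainNorm, Finsupp.sum_single_index]
    have h1 := hgn (Finsupp.single (a, b) 1)
    have h2 := hgn ((-1 : ℝ) • Finsupp.single (a, b) 1)
    rw [chainNorm_smul, map_smul] at h2
    rw [hn] at h1 h2
    simp only [smul_eq_mul, abs_neg, abs_one] at h2
    rw [abs_le]
    constructor <;> linarith
  · change ψ (orbitChain y) = c
    rw [← hx, hψ', hgx]

/-- The hard direction of Bavard duality, in coarse form: `scl(y)` is detected by some invariant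
homogeneous quasimorphism of defect at most `4`. -/
theorem exists_mixedScl_le_evalAt (y : mixedCommutator N) : ∃ Φ : invQuasimorphisms N,
    (∀ a b, |(Φ : N → ℝ) (a * b) - (Φ : N → ℝ) a - (Φ : N → ℝ) b| ≤ 4) ∧
      mixedScl N y ≤ 4 * |evalAt Φ y| + 10 := by
  set y' := Subgroup.inclusion (Subgroup.commutator_le_right ⊤ N) y with hy'
  obtain ⟨φ, hφ, hφi, hφy⟩ := exists_invariant_quasimorphism y' (exists_boundary_eq y)
    (c := max ((mixedScl N y - 6) / 4) 0) (le_max_right _ _) (fun a ha => by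
      refine max_le ?_ (chainNorm_nonneg a)
      linarith [mixedScl_le_of_boundary_eq y a ha])
  obtain ⟨Φ, hhom, hclose, hsymm⟩ := exists_homogenization hφ
  have hΦ : ∀ a b, |Φ (a * b) - Φ a - Φ b| ≤ 4 := by
    intro a b
    have h0 := hφ a b
    have h1 := hclose (a * b)
    have h2 := hclose a
    have h3 := hclose b
    rw [abs_le] at *
    constructor <;> linarith [h0.1, h0.2, h1.1, h1.2, h2.1, h2.2, h3.1, h3.2]
  refine ⟨⟨Φ, ⟨4, hΦ⟩, hhom, fun g => hsymm (MulAut.conjNormal g) (hφi g)⟩, hΦ, ?_⟩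
  change mixedScl N y ≤ 4 * |Φ y'| + 10
  have h1 := (abs_le.1 (hclose y')).1
  have h2 := le_max_left ((mixedScl N y - 6) / 4) 0
  rw [← hφy] at h2
  linarith [le_abs_self (Φ y')]

end Chains

/-! ### Dual families -/

section DualFamilies

variable {G : Type*} [Group G] {N : Subgroup G} [hN : N.Normal]

/-- Evaluation at `y ∈ [G,N]`, as a linear form on `Q(N)^G / H¹(N)^G`. -/
def evalClass (y : mixedCommutator N) : Module.Dual ℝ (InvQuotient N) :=
  Submodule.liftQ _
    ((LinearMap.proj (Subgroup.inclusion (Subgroup.commutator_le_right ⊤ N) y)).comp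
      (invQuasimorphisms N).subtype)
    (fun ν hν => evalAt_eq_zero_of_mem ν hν y)

theorem evalClass_invClass (y : mixedCommutator N) (ν : invQuasimorphisms N) :
    evalClass y (invClass ν) = evalAt ν y :=
  rfl

theorem exists_invClass_eq (q : InvQuotient N) : ∃ ν, invClass ν = q :=
  Submodule.Quotient.mk_surjective _ q

/-- The restriction map from `Q(N)^G / H¹(N)^G` to functions on `[G,N]` is injective. -/
theorem eq_zero_of_evalClass_eq_zero (q : InvQuotient N) (h : ∀ y, evalClass y q = 0) : q = 0 := by
  obtain ⟨ν, rfl⟩ := exists_invClass_eq q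
  refine (Submodule.Quotient.mk_eq_zero _).2 ?_
  exact mem_invHomomorphisms_of_evalAt_eq_zero ν h

/-- Since evaluations separate the points of the finite dimensional space `Q(N)^G / H¹(N)^G`, they
span its dual; a basis of the dual consisting of evaluations has a dual basis. -/
theorem exists_isDualPair [Module.Finite ℝ (InvQuotient N)] {ℓ : ℕ}
    (hℓ : Module.finrank ℝ (InvQuotient N) = ℓ) :
    ∃ (ν : Fin ℓ → invQuasimorphisms N) (y : Fin ℓ → mixedCommutator N), IsDualPair ν y := by
  set S : Set (Module.Dual ℝ (InvQuotient N)) := Set.range evalClass with hS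
  have hspan : Submodule.span ℝ S = ⊤ := by
    have h : (Submodule.span ℝ S).dualCoannihilator = ⊥ := by
      refine (Submodule.eq_bot_iff _).2 fun q hq => eq_zero_of_evalClass_eq_zero q fun y => ?_
      rw [Submodule.mem_dualCoannihilator] at hq
      exact hq _ (Submodule.subset_span ⟨y, rfl⟩)
    rw [← Subspace.dualCoannihilator_dualAnnihilator_eq (W := Submodule.span ℝ S), h,
      Submodule.dualAnnihilator_bot]
  have hrank : Module.finrank ℝ (Submodule.span ℝ S) = ℓ := by
    rw [hspan, finrank_top, Subspace.dual_finrank_eq, hℓ]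
  obtain ⟨f, hfS, hf, hli⟩ : ∃ f : Fin ℓ → Module.Dual ℝ (InvQuotient N),
      (∀ i, f i ∈ S) ∧ Submodule.span ℝ (Set.range f) = Submodule.span ℝ S ∧
        LinearIndependent ℝ f := by
    subst hrank
    exact Submodule.exists_fun_fin_finrank_span_eq ℝ S
  choose y hy using hfS
  set b := Module.Basis.mk hli (by rw [hf, hspan])
  choose ν hν using fun j =>
    exists_invClass_eq ((Module.evalEquiv ℝ (InvQuotient N)).symm (b.coord j))
  refine ⟨ν, y, fun i j => ?_⟩
  have hbi : f i = b i := by simp [b]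
  rw [← evalClass_invClass, hy, hν, Module.apply_evalEquiv_symm_apply, hbi,
    Module.Basis.coord_apply, Module.Basis.repr_self, Finsupp.single_apply]

variable {ℓ : ℕ} {ν : Fin ℓ → invQuasimorphisms N} {y : Fin ℓ → mixedCommutator N}

theorem IsDualPair.evalClass_sum (h : IsDualPair ν y) (c : Fin ℓ → ℝ) (i : Fin ℓ) :
    evalClass (y i) (∑ j, c j • invClass (ν j)) = c i := by
  have h' : ∀ j, evalClass (y i) (invClass (ν j)) = if i = j then 1 else 0 := h i
  simp [map_sum, map_smul, h']

theorem IsDualPair.linearIndependent (h : IsDualPair ν y) :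
    LinearIndependent ℝ fun j => invClass (ν j) := by
  refine Fintype.linearIndependent_iff.2 fun c hc i => ?_
  rw [← h.evalClass_sum c i, hc, map_zero]

theorem IsDualPair.span_eq_top [Module.Finite ℝ (InvQuotient N)] (h : IsDualPair ν y)
    (hℓ : Module.finrank ℝ (InvQuotient N) = ℓ) :
    Submodule.span ℝ (Set.range fun j => invClass (ν j)) = ⊤ :=
  h.linearIndependent.span_eq_top_of_card_eq_finrank' (by simp [hℓ])

theorem IsDualPair.evalAt_eq_sum (h : IsDualPair ν y)
    (hspan : Submodule.span ℝ (Set.range fun j => invClass (ν j)) = ⊤)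
    (Φ : invQuasimorphisms N) (z : mixedCommutator N) :
    evalAt Φ z = ∑ i, evalAt Φ (y i) * evalAt (ν i) z := by
  obtain ⟨c, hc⟩ := (Submodule.mem_span_range_iff_exists_fun ℝ).1
    (hspan ▸ Submodule.mem_top : invClass Φ ∈ Submodule.span ℝ (Set.range fun j => invClass (ν j)))
  have hci : ∀ i, c i = evalAt Φ (y i) := fun i => by
    rw [← h.evalClass_sum c i, hc, evalClass_invClass]
  rw [← evalClass_invClass, ← hc]
  simp [map_sum, map_smul, hci, evalClass_invClass]

end DualFamilies

/-! ### Comparison of the two metrics -/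

section Comparison

variable {G : Type*} [Group G] {N : Subgroup G} [hN : N.Normal] {ℓ : ℕ}
  {ν : Fin ℓ → invQuasimorphisms N} {y : Fin ℓ → mixedCommutator N}

/-- The upper bound follows from Bavard duality because all invariant quasimorphisms of defect at
most `4` have bounded coordinates `Φ(yᵢ)` with respect to the `νᵢ`. -/
theorem IsDualPair.exists_mixedScl_le (h : IsDualPair ν y)
    (hspan : Submodule.span ℝ (Set.range fun j => invClass (ν j)) = ⊤) :
    ∃ A ≥ (0 : ℝ), ∀ z, mixedScl N z ≤ A * (∑ i, |evalAt (ν i) z|) + 10 := by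
  set B : ℝ := ∑ i, 8 * (mixedCl N (y i) : ℝ) with hB
  refine ⟨4 * B, by positivity, fun z => ?_⟩
  obtain ⟨Φ, hΦ, hz⟩ := exists_mixedScl_le_evalAt z
  have h1 : |evalAt Φ z| ≤ B * ∑ i, |evalAt (ν i) z| := by
    rw [h.evalAt_eq_sum hspan Φ z, Finset.mul_sum]
    refine (Finset.abs_sum_le_sum_abs _ _).trans (Finset.sum_le_sum fun i _ => ?_)
    rw [abs_mul]
    gcongr
    calc |evalAt Φ (y i)| ≤ 2 * 4 * mixedCl N (y i) := abs_evalAt_le_mixedCl Φ hΦ (y i)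
      _ = 8 * (mixedCl N (y i) : ℝ) := by ring
      _ ≤ B := Finset.single_le_sum (f := fun i => 8 * (mixedCl N (y i) : ℝ))
          (fun _ _ => by positivity) (Finset.mem_univ i)
  linarith

theorem exists_sum_abs_evalAt_le (ν : Fin ℓ → invQuasimorphisms N) :
    ∃ A ≥ (0 : ℝ), ∀ z, ∑ i, |evalAt (ν i) z| ≤ A * mixedScl N z := by
  choose C hC0 hC using fun i => exists_abs_evalAt_le_mixedScl (ν i)
  refine ⟨∑ i, C i, Finset.sum_nonneg fun i _ => hC0 i, fun z => ?_⟩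
  rw [Finset.sum_mul]
  exact Finset.sum_le_sum fun i _ => hC i z

theorem exists_sum_abs_evalAt_mul_sub_le (ν : Fin ℓ → invQuasimorphisms N) :
    ∃ D ≥ (0 : ℝ), ∀ a b, ∑ i, |evalAt (ν i) (a * b) - evalAt (ν i) a - evalAt (ν i) b| ≤ D := by
  choose D hD0 hD using fun i => exists_abs_evalAt_mul_sub_le (ν i)
  exact ⟨∑ i, D i, Finset.sum_nonneg fun i _ => hD0 i, fun a b =>
    Finset.sum_le_sum fun i _ => hD i a b⟩

/-- The distance in `ℝ^ℓ` of the values of `(ν₁, …, ν_ℓ)` at two elements. -/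
def evalDist (ν : Fin ℓ → invQuasimorphisms N) (a b : mixedCommutator N) : ℝ :=
  ∑ i, |evalAt (ν i) a - evalAt (ν i) b|

/-- The distance in `ℝ^ℓ` of the value of `(ν₁, …, ν_ℓ)` at an element from an integral point. -/
def roundDist (ν : Fin ℓ → invQuasimorphisms N) (a : mixedCommutator N) (m : ZGroup ℓ) : ℝ :=
  ∑ i, |evalAt (ν i) a - m.coord i|

/-- Up to affine inequalities, `d_scl` is the metric induced by `(ν₁, …, ν_ℓ)`. -/
theorem IsDualPair.exists_comparison (h : IsDualPair ν y)
    (hspan : Submodule.span ℝ (Set.range fun j => invClass (ν j)) = ⊤) :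
    ∃ A > (0 : ℝ), ∃ B ≥ (0 : ℝ), ∀ a b, sclDist N a b ≤ A * evalDist ν a b + B ∧
      evalDist ν a b ≤ A * sclDist N a b + B := by
  obtain ⟨A₁, hA₁, h₁⟩ := h.exists_mixedScl_le hspan
  obtain ⟨A₂, hA₂, h₂⟩ := exists_sum_abs_evalAt_le ν
  obtain ⟨D, hD0, hD⟩ := exists_sum_abs_evalAt_mul_sub_le ν
  refine ⟨A₁ + A₂ + 1, by positivity, (A₁ + 1) * D + 10, by positivity, fun a b => ?_⟩
  have hD' := hD a⁻¹ b
  have hle : evalDist ν a b ≤ D + ∑ i, |evalAt (ν i) (a⁻¹ * b)| := by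
    refine le_trans ?_ (add_le_add_left hD' _)
    rw [evalDist, ← Finset.sum_add_distrib]
    refine Finset.sum_le_sum fun i _ => ?_
    rw [evalAt_inv, ← abs_neg (evalAt (ν i) (a⁻¹ * b) - _ - _)]
    refine le_trans ?_ (abs_add_le _ _)
    rw [abs_sub_comm]
    exact le_of_eq (congrArg abs (by ring))
  have hge : ∑ i, |evalAt (ν i) (a⁻¹ * b)| ≤ D + evalDist ν a b := by
    refine le_trans ?_ (add_le_add_left hD' _)
    rw [evalDist, ← Finset.sum_add_distrib]
    refine Finset.sum_le_sum fun i _ => ?_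
    rw [evalAt_inv, abs_sub_comm (evalAt (ν i) a)]
    refine le_trans ?_ (abs_add_le _ _)
    exact le_of_eq (congrArg abs (by ring))
  have hs := h₁ (a⁻¹ * b)
  have hs' := h₂ (a⁻¹ * b)
  have hs0 := mixedScl_nonneg (a⁻¹ * b)
  have hd0 : 0 ≤ evalDist ν a b := Finset.sum_nonneg fun _ _ => abs_nonneg _
  have hA₁D : 0 ≤ A₁ * D := by positivity
  rw [sclDist]
  constructor
  · have := mul_le_mul_of_nonneg_left hge hA₁
    have := mul_nonneg hA₂ hd0
    linarith
  · have := mul_nonneg hA₁ hs0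
    linarith

end Comparison

/-! ### The power map -/

section PowerMap

variable {G : Type*} [Group G] {N : Subgroup G} [hN : N.Normal] {ℓ : ℕ}

theorem mixedCl_prod_ofFn_le {n : ℕ} (a : Fin n → mixedCommutator N) :
    mixedCl N (List.ofFn a).prod ≤ ∑ i, mixedCl N (a i) := by
  induction n with
  | zero => simp [mixedCl_one]
  | succ n ih =>
    rw [List.ofFn_succ, List.prod_cons, Fin.sum_univ_succ]
    exact (mixedCl_mul_le N _ _).trans (Nat.add_le_add_left (ih _) _)

theorem abs_evalAt_prod_ofFn_sub_le {ν : invQuasimorphisms N} {D : ℝ}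
    (hD : ∀ a b, |evalAt ν (a * b) - evalAt ν a - evalAt ν b| ≤ D) {n : ℕ}
    (a : Fin n → mixedCommutator N) :
    |evalAt ν (List.ofFn a).prod - ∑ i, evalAt ν (a i)| ≤ n * D := by
  induction n with
  | zero => simp [evalAt_one]
  | succ n ih =>
    rw [List.ofFn_succ, List.prod_cons, Fin.sum_univ_succ]
    have h1 := hD (a 0) (List.ofFn fun i => a i.succ).prod
    have h2 := ih fun i => a i.succ
    rw [abs_le] at *
    push_cast
    constructor <;> linarith [h1.1, h1.2, h2.1, h2.2]

theorem IsDualPair.exists_roundDist_powerMap_le {ν : Fin ℓ → invQuasimorphisms N}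
    {y : Fin ℓ → mixedCommutator N} (h : IsDualPair ν y) :
    ∃ K ≥ (0 : ℝ), ∀ m, roundDist ν (powerMap y m) m ≤ K := by
  choose D hD0 hD using fun i => exists_abs_evalAt_mul_sub_le (ν i)
  refine ⟨∑ i, ℓ * D i, Finset.sum_nonneg fun i _ => mul_nonneg (Nat.cast_nonneg _) (hD0 i),
    fun m => Finset.sum_le_sum fun j _ => ?_⟩
  have h1 := abs_evalAt_prod_ofFn_sub_le (hD j) fun i => y i ^ m.coord i
  have h2 : ∑ i, evalAt (ν j) (y i ^ m.coord i) = m.coord j := by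
    simp [evalAt_pow, h _ j]
  rwa [h2] at h1

theorem mixedCl_powerMap_mul_le (y : Fin ℓ → mixedCommutator N) (m n : ZGroup ℓ) :
    mixedCl N ((powerMap y (m * n))⁻¹ * (powerMap y m * powerMap y n)) ≤ ℓ := by
  obtain ⟨w, hw, hwe⟩ := exists_prod_ofFn_mul_eq (N := N)
    (fun i => ((y i ^ m.coord i : mixedCommutator N) : G))
    (fun i => ((y i ^ n.coord i : mixedCommutator N) : G))
    (fun i => Subgroup.commutator_le_right ⊤ N (y i ^ m.coord i).2)
    (fun i => Subgroup.commutator_le_right ⊤ N (y i ^ n.coord i).2)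
  have hcoe : ∀ a : Fin ℓ → mixedCommutator N,
      (((List.ofFn a).prod : mixedCommutator N) : G) = (List.ofFn fun i => (a i : G)).prod := by
    intro a
    rw [Subgroup.val_list_prod, List.map_ofFn]
    rfl
  have hmul : ((powerMap y (m * n) : mixedCommutator N) : G)
      = w * (powerMap y m * powerMap y n) := by
    rw [powerMap, powerMap, powerMap, hcoe, hcoe, hcoe, ← hwe]
    congr 2
    funext i
    rw [← Subgroup.coe_mul, ← zpow_add]
    rfl
  refine mixedCl_le ?_
  have h := mem_commutatorLengths_conj (mem_commutatorLengths_inv hw)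
    ((powerMap y m * powerMap y n : mixedCommutator N) : G)⁻¹
  convert h using 1
  rw [Subgroup.coe_mul, Subgroup.coe_inv, hmul, Subgroup.coe_mul]
  group

/-- `τ(m)⁻¹ τ(n)` agrees with `τ(n - m)` up to `ℓ` simple commutators, and the length of the latter is
at most `∑ᵢ |nᵢ - mᵢ| cl(yᵢ)`. -/
theorem exists_clDist_powerMap_le (y : Fin ℓ → mixedCommutator N) :
    ∃ C > (0 : ℝ), ∃ D ≥ (0 : ℝ), ∀ m n,
      clDist N (powerMap y m) (powerMap y n) ≤ C * l1Dist ℓ m n + D := by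
  refine ⟨∑ i, (mixedCl N (y i) : ℝ) + 1, by positivity, ℓ, by positivity, fun m n => ?_⟩
  set k := m⁻¹ * n with hk
  have h1 := mixedCl_powerMap_mul_le y m k
  have hmk : m * k = n := by rw [hk, mul_inv_cancel_left]
  rw [hmk] at h1
  have h2 := mixedCl_mul_le N (powerMap y k)
    ((powerMap y n)⁻¹ * (powerMap y m * powerMap y k))⁻¹
  rw [mixedCl_inv] at h2
  have h3 : powerMap y k * ((powerMap y n)⁻¹ * (powerMap y m * powerMap y k))⁻¹
      = (powerMap y m)⁻¹ * powerMap y n := by group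
  rw [h3] at h2
  have h4 : (mixedCl N (powerMap y k) : ℝ) ≤ (∑ i, (mixedCl N (y i) : ℝ)) * l1Dist ℓ m n := by
    have h5 : (mixedCl N (powerMap y k) : ℝ) ≤ ∑ i, (mixedCl N (y i ^ k.coord i) : ℝ) := by
      exact_mod_cast mixedCl_prod_ofFn_le fun i => y i ^ k.coord i
    refine h5.trans ?_
    rw [l1Dist, Finset.mul_sum]
    refine Finset.sum_le_sum fun i _ => (mixedCl_zpow_le _ _).trans ?_
    have hki : (k.coord i : ℝ) = -((m.coord i : ℝ) - n.coord i) := by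
      have : k.coord i = -m.coord i + n.coord i := rfl
      rw [this]; push_cast; ring
    rw [hki, abs_neg, mul_comm]
    gcongr
    exact Finset.single_le_sum (f := fun i => (mixedCl N (y i) : ℝ))
      (fun _ _ => by positivity) (Finset.mem_univ i)
  have h6 : (mixedCl N ((powerMap y m)⁻¹ * powerMap y n) : ℝ) ≤ mixedCl N (powerMap y k) + ℓ := by
    exact_mod_cast h2.trans (Nat.add_le_add_left h1 _)
  have h7 : 0 ≤ l1Dist ℓ m n := Finset.sum_nonneg fun _ _ => abs_nonneg _
  rw [clDist]
  linarith

end PowerMap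

/-! ### Coarse equivalence -/

theorem isBiinvariantAlmostMetric_l1Dist (ℓ : ℕ) : IsBiinvariantAlmostMetric (l1Dist ℓ) where
  nonneg m n := Finset.sum_nonneg fun _ _ => abs_nonneg _
  self m := by simp [l1Dist]
  symm m n := Finset.sum_congr rfl fun i _ => abs_sub_comm _ _
  triangle := by
    refine ⟨0, fun m n k => ?_⟩
    rw [add_zero, l1Dist, l1Dist, l1Dist, ← Finset.sum_add_distrib]
    exact Finset.sum_le_sum fun i _ => abs_sub_le _ _ _
  biinvariant a b m n := by
    refine Finset.sum_congr rfl fun i _ => ?_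
    have h : ∀ x : ZGroup ℓ, (a * x * b).coord i = a.coord i + x.coord i + b.coord i :=
      fun _ => rfl
    rw [h, h]
    push_cast
    congr 1
    ring

theorem IsQIEmbedding.isControlled {X Y : Type*} {dX : X → X → ℝ} {dY : Y → Y → ℝ} {α : X → Y}
    (h : IsQIEmbedding dX dY α) : IsControlled dX dY α := by
  obtain ⟨_, _, C, hC, _, _, D, _, h⟩ := h
  refine fun S => ⟨C * S + D, fun x x' hx => (h x x').2.trans ?_⟩
  gcongr

section CoarseEquivalence

variable {G : Type*} [Group G] {N : Subgroup G} [hN : N.Normal] {ℓ : ℕ}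
  {ν : Fin ℓ → invQuasimorphisms N} {y : Fin ℓ → mixedCommutator N}

theorem l1Dist_le_roundDist_add (a : mixedCommutator N) (m n : ZGroup ℓ) :
    l1Dist ℓ m n ≤ roundDist ν a m + roundDist ν a n := by
  rw [l1Dist, roundDist, roundDist, ← Finset.sum_add_distrib]
  refine Finset.sum_le_sum fun i _ => (abs_sub_le _ (evalAt (ν i) a) _).trans_eq ?_
  rw [abs_sub_comm]

theorem evalDist_le_roundDist_add (a b : mixedCommutator N) (m : ZGroup ℓ) :
    evalDist ν a b ≤ roundDist ν a m + roundDist ν b m := by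
  rw [evalDist, roundDist, roundDist, ← Finset.sum_add_distrib]
  refine Finset.sum_le_sum fun i _ => (abs_sub_le _ (m.coord i : ℝ) _).trans_eq ?_
  rw [abs_sub_comm (m.coord i : ℝ)]

theorem abs_l1Dist_sub_evalDist_le (a b : mixedCommutator N) (m n : ZGroup ℓ) :
    |l1Dist ℓ m n - evalDist ν a b| ≤ roundDist ν a m + roundDist ν b n := by
  rw [l1Dist, evalDist, roundDist, roundDist, ← Finset.sum_add_distrib, ← Finset.sum_sub_distrib]
  refine (Finset.abs_sum_le_sum_abs _ _).trans (Finset.sum_le_sum fun i _ => ?_)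
  refine (abs_abs_sub_abs_le_abs_sub _ _).trans ?_
  rw [← abs_neg (evalAt (ν i) a - _)]
  refine le_trans (le_of_eq (congrArg abs ?_)) (abs_add_le _ _)
  ring

theorem roundDist_mul_le (a b : mixedCommutator N) (m n : ZGroup ℓ) :
    roundDist ν (a * b) (m * n)
      ≤ ∑ i, |evalAt (ν i) (a * b) - evalAt (ν i) a - evalAt (ν i) b|
        + roundDist ν a m + roundDist ν b n := by
  rw [roundDist, roundDist, roundDist, ← Finset.sum_add_distrib, ← Finset.sum_add_distrib]
  refine Finset.sum_le_sum fun i _ => ?_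
  have h : (m * n).coord i = m.coord i + n.coord i := rfl
  rw [h]
  push_cast
  refine le_trans (le_of_eq (congrArg abs ?_)) (abs_add_three _ _ _)
  ring

/-- Everything asserted about `σ` and `τ` follows from the comparison of `d_scl` with the metric
induced by `(ν₁, …, ν_ℓ)`, because `m ↦ τ m` and `y ↦ σ y` change coordinates by a bounded
amount only. -/
theorem IsDualPair.coarse_equivalence (h : IsDualPair ν y)
    (hspan : Submodule.span ℝ (Set.range fun j => invClass (ν j)) = ⊤)
    {ρ : (Fin ℓ → ℝ) → ZGroup ℓ} (hρ : IsRounding ρ)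
    {σ : mixedCommutator N → ZGroup ℓ} {τ : ZGroup ℓ → mixedCommutator N}
    (hσ : σ = ρ ∘ evalMap ν) (hτ : τ = powerMap y) :
    (IsPreCoarseHom (l1Dist ℓ) σ ∧ IsPreCoarseHom (clDist N) τ) ∧
    IsQIEmbedding (sclDist N) (l1Dist ℓ) σ ∧
    (∃ C > (0 : ℝ), ∃ C' > (0 : ℝ), ∃ D ≥ (0 : ℝ), ∃ D' ≥ (0 : ℝ), ∀ m n : ZGroup ℓ,
      C * l1Dist ℓ m n - D ≤ sclDist N (τ m) (τ n) ∧
      sclDist N (τ m) (τ n) ≤ clDist N (τ m) (τ n) ∧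
      clDist N (τ m) (τ n) ≤ C' * l1Dist ℓ m n + D') ∧
    AreCoarseInverse (sclDist N) (l1Dist ℓ) σ τ ∧
    IsCoarseGroupIso (sclDist N) (l1Dist ℓ) σ τ ∧
    IsQuasiIsometry (sclDist N) (l1Dist ℓ) σ ∧
    IsQuasiIsometry (l1Dist ℓ) (sclDist N) τ := by
  obtain ⟨A, hA, B, hB, hAB⟩ := h.exists_comparison hspan
  obtain ⟨D, hD0, hD⟩ := exists_sum_abs_evalAt_mul_sub_le ν
  obtain ⟨K₂, hK₂, hτr⟩ := h.exists_roundDist_powerMap_le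
  obtain ⟨C, hC, E, hE, hcl⟩ := exists_clDist_powerMap_le y
  rw [← hτ] at hτr hcl
  obtain ⟨K₁, hK₁, hσr⟩ : ∃ K ≥ (0 : ℝ), ∀ a, roundDist ν a (σ a) ≤ K := by
    obtain ⟨K, hK⟩ := hρ
    have hK' : ∀ a, roundDist ν a (σ a) ≤ K := fun a => by rw [hσ]; exact hK (evalMap ν a)
    exact ⟨K, (Finset.sum_nonneg fun _ _ => abs_nonneg _).trans (hK' 1), hK'⟩
  have hsc : ∀ a b, sclDist N a b ≤ clDist N a b := fun a b => mixedScl_le_mixedCl _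
  have hpreσ : IsPreCoarseHom (l1Dist ℓ) σ := by
    refine ⟨K₁ + (D + K₁ + K₁), fun a b => ?_⟩
    have h1 := l1Dist_le_roundDist_add (ν := ν) (a * b) (σ (a * b)) (σ a * σ b)
    have h2 := roundDist_mul_le (ν := ν) a b (σ a) (σ b)
    linarith [hσr (a * b), hσr a, hσr b, hD a b]
  have hpreτ : IsPreCoarseHom (clDist N) τ := by
    refine ⟨ℓ, fun m n => ?_⟩
    rw [hτ, clDist]
    exact_mod_cast mixedCl_powerMap_mul_le y m n
  have hqσ : IsQIEmbedding (sclDist N) (l1Dist ℓ) σ := by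
    refine ⟨A⁻¹, inv_pos.2 hA, A, hA, 2 * K₁ + A⁻¹ * B, by positivity, 2 * K₁ + B, by positivity,
      fun a b => ?_⟩
    obtain ⟨h1, h2⟩ := hAB a b
    have h3 := abs_le.1 (abs_l1Dist_sub_evalDist_le (ν := ν) a b (σ a) (σ b))
    have ha := hσr a
    have hb := hσr b
    constructor
    · have h4 := mul_le_mul_of_nonneg_left h1 (inv_pos.2 hA).le
      rw [mul_add, inv_mul_cancel_left₀ hA.ne'] at h4
      linarith [h3.1]
    · linarith [h3.2]
  have hlow : ∀ m n, A⁻¹ * l1Dist ℓ m n - A⁻¹ * (2 * K₂ + B) ≤ sclDist N (τ m) (τ n) := by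
    intro m n
    have h2 := (hAB (τ m) (τ n)).2
    have h3 := abs_le.1 (abs_l1Dist_sub_evalDist_le (ν := ν) (τ m) (τ n) m n)
    rw [← mul_sub, inv_mul_le_iff₀ hA]
    linarith [h3.2, hτr m, hτr n]
  have hqτ : IsQIEmbedding (l1Dist ℓ) (sclDist N) τ :=
    ⟨A⁻¹, inv_pos.2 hA, C, hC, A⁻¹ * (2 * K₂ + B), by positivity, E, hE,
      fun m n => ⟨hlow m n, (hsc _ _).trans (hcl m n)⟩⟩
  have hclose₁ : AreClose (sclDist N) (τ ∘ σ) id := by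
    refine ⟨A * (K₂ + K₁) + B, fun a => ?_⟩
    refine (hAB _ _).1.trans ?_
    have h1 := evalDist_le_roundDist_add (ν := ν) (τ (σ a)) a (σ a)
    have h2 : evalDist ν (τ (σ a)) a ≤ K₂ + K₁ := by linarith [hτr (σ a), hσr a]
    simp only [Function.comp_apply, id]
    gcongr
  have hclose₂ : AreClose (l1Dist ℓ) (σ ∘ τ) id := by
    refine ⟨K₁ + K₂, fun m => ?_⟩
    have h1 := l1Dist_le_roundDist_add (ν := ν) (τ m) (σ (τ m)) m
    simp only [Function.comp_apply, id]
    linarith [hσr (τ m), hτr m]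
  have hinv : AreCoarseInverse (sclDist N) (l1Dist ℓ) σ τ :=
    ⟨hqσ.isControlled, hqτ.isControlled, hclose₁, hclose₂⟩
  have hinv' : AreCoarseInverse (l1Dist ℓ) (sclDist N) τ σ :=
    ⟨hqτ.isControlled, hqσ.isControlled, hclose₂, hclose₁⟩
  have hpreτ' : IsPreCoarseHom (sclDist N) τ := by
    obtain ⟨K, hK⟩ := hpreτ
    exact ⟨K, fun m n => (hsc _ _).trans (hK m n)⟩
  exact ⟨⟨hpreσ, hpreτ⟩, hqσ,
    ⟨A⁻¹, inv_pos.2 hA, C, hC, A⁻¹ * (2 * K₂ + B), by positivity, E, hE,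
      fun m n => ⟨hlow m n, hsc _ _, hcl m n⟩⟩, hinv,
    ⟨isBiinvariantAlmostMetric_sclDist, isBiinvariantAlmostMetric_l1Dist ℓ, hpreσ, hpreτ', hinv⟩,
    ⟨hqσ, τ, hqτ, hinv⟩, ⟨hqτ, σ, hqσ, hinv'⟩⟩

end CoarseEquivalence

theorem mainTheorem4 {G : Type*} [Group G] (N : Subgroup G) [N.Normal]
    (hfin : Module.Finite ℝ (InvQuotient N)) (ℓ : ℕ)
    (hℓ : Module.finrank ℝ (InvQuotient N) = ℓ) :
    -- `([G,N], d_scl)` and `(ℤ^ℓ, ‖·‖₁)` are isomorphic as coarse groups by quasi-isometries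
    (∃ (σ : mixedCommutator N → ZGroup ℓ) (τ : ZGroup ℓ → mixedCommutator N),
      IsCoarseGroupIso (sclDist N) (l1Dist ℓ) σ τ ∧
      IsQuasiIsometry (sclDist N) (l1Dist ℓ) σ ∧
      IsQuasiIsometry (l1Dist ℓ) (sclDist N) τ) ∧
    -- dual families exist
    (∃ (ν : Fin ℓ → invQuasimorphisms N) (y : Fin ℓ → mixedCommutator N), IsDualPair ν y) ∧
    -- and any dual families realize the isomorphism
    (∀ (ν : Fin ℓ → invQuasimorphisms N) (y : Fin ℓ → mixedCommutator N), IsDualPair ν y →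
      (LinearIndependent ℝ (fun j => invClass (ν j)) ∧
        Submodule.span ℝ (Set.range fun j => invClass (ν j)) = ⊤) ∧
      ∀ (ρ : (Fin ℓ → ℝ) → ZGroup ℓ), IsRounding ρ →
      ∀ (σ : mixedCommutator N → ZGroup ℓ) (τ : ZGroup ℓ → mixedCommutator N),
        σ = ρ ∘ evalMap ν → τ = powerMap y →
        (IsPreCoarseHom (l1Dist ℓ) σ ∧ IsPreCoarseHom (clDist N) τ) ∧
        IsQIEmbedding (sclDist N) (l1Dist ℓ) σ ∧
        (∃ C > (0 : ℝ), ∃ C' > (0 : ℝ), ∃ D ≥ (0 : ℝ), ∃ D' ≥ (0 : ℝ), ∀ m n : ZGroup ℓ,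
          C * l1Dist ℓ m n - D ≤ sclDist N (τ m) (τ n) ∧
          sclDist N (τ m) (τ n) ≤ clDist N (τ m) (τ n) ∧
          clDist N (τ m) (τ n) ≤ C' * l1Dist ℓ m n + D') ∧
        AreCoarseInverse (sclDist N) (l1Dist ℓ) σ τ ∧
        IsCoarseGroupIso (sclDist N) (l1Dist ℓ) σ τ ∧
        IsQuasiIsometry (sclDist N) (l1Dist ℓ) σ ∧
        IsQuasiIsometry (l1Dist ℓ) (sclDist N) τ) := by
  obtain ⟨ν, y, h⟩ := exists_isDualPair hℓ
  refine ⟨?_, ⟨ν, y, h⟩, fun ν y h => ⟨⟨h.linearIndependent, h.span_eq_top hℓ⟩,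
    fun ρ hρ σ τ hσ hτ => h.coarse_equivalence (h.span_eq_top hℓ) hρ hσ hτ⟩⟩
  obtain ⟨-, -, -, -, hiso, hqσ, hqτ⟩ :=
    h.coarse_equivalence (h.span_eq_top hℓ) (isRounding_floor ℓ) rfl rfl
  exact ⟨_, _, hiso, hqσ, hqτ⟩
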